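/- Let $\mathcal N$ be a finite set of nodes with $n$ elements, and let $\mathcal D$ be the set of dyads, i.e. of unordered pairs $ij$ of distinct nodes. Let $P$ be an exchangeable distribution of a random network $X=(X_d)_{d\in\mathcal D}$, i.e. a distribution that is invariant under relabelling of the nodes (the $X_d$ take values in a common standard Borel space, e.g. $\{0,1\}$). For pairwise disjoint $A,B,C\subseteq\mathcal D$ write $A\perp\!\!\!\perp B\mid C$ if $X_A$ and $X_B$ are conditionally independent given $X_C$ under $P$. A chain mixed graph is a loopless graph with lines $u - v$, arrows $u\to v$ and arcs $u\leftrightarrow v$ (edges of different types between the same two vertices are allowed) that has no closed walk made of lines and of arrows pointing in the direction of the walk with at least one arrow. A section of a walk is a maximal subwalk consisting of lines only (possibly a single vertex); it is a collider section if the walk enters it and leaves it through edges that have arrowheads at the section, and otherwise, in particular if it contains an end of the walk, a non-collider section. A walk is connecting given $C$ if all its collider sections intersect $C$ and all its non-collider sections are disjoint from $C$. For pairwise disjoint $A,B,C$, the set $C$ separates $A$ and $B$ if there is no connecting walk given $C$ between a vertex of $A$ and a vertex of $B$. Two graphs on the same vertex set are Markov equivalent if they have the same separations. $P$ is faithful to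 a graph $G$ on the vertex set $\mathcal D$ if, for all pairwise disjoint $A,B,C\subseteq\mathcal D$, $C$ separates $A$ and $B$ in $G$ if and only if $A\perp\!\!\!\perp B\mid C$. The incidence graph on $\mathcal D$ joins two distinct dyads if they share a node. Let $L_{-}(n)$ and $L_{\leftrightarrow}(n)$ be the incidence graph with all edges lines and with all edges arcs, respectively, and let $L^c_{-}(n)$ and $L^c_{\leftrightarrow}(n)$ be the complement of the incidence graph with all edges lines and with all edges arcs, respectively. Consider the following test for five distinct nodes $i,j,k,l,m\in\mathcal N$, in which $C$ ranges over the subsets of $\mathcal D\setminus\{ij,kl\}$ and $C'$ over the subsets of $\mathcal D\setminus\{ij,ik\}$. - If $ij\perp\!\!\!\perp kl\mid C$ for some $C$ and $ij\perp\!\!\!\perp ik\mid C'$ for some $C'$, answer: the empty graph. - If $ij\perp\!\!\!\perp kl\mid C$ for some $C$, and $ij\perp\!\!\!\perp ik\mid C'$ for no $C'$, take any such $C$ and answer: $L_{-}(n)$ if $ik\in C$, and $L_{\leftrightarrow}(n)$ if $ik\notin C$. - If $ij\perp\!\!\!\perp kl\mid C$ for no $C$, and $ij\perp\!\!\!\perp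 ik\mid C'$ for some $C'$, take any such $C'$ and answer: $L^c_{-}(n)$ if $lm\in C'$, and $L^c_{\leftrightarrow}(n)$ if $lm\notin C'$. - If $ij\perp\!\!\!\perp kl\mid C$ for no $C$ and $ij\perp\!\!\!\perp ik\mid C'$ for no $C'$, answer: the complete graph. Proposition. Suppose that the exchangeable distribution $P$ is faithful to a chain mixed graph $G$ on $\mathcal D$. Then, for all distinct nodes $i,j,k,l,m$, the test determines the Markov equivalence class of $G$: it has exactly one possible answer, whichever separating sets $C$, $C'$ are used, and, among the six graphs above, this answer is the one and only graph to which $G$ is Markov equivalent. -/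

import Mathlib

open MeasureTheory ProbabilityTheory

/-! ### Mixed graphs and their separation criterion -/

/-- A mixed graph on the vertex set `V`: a loopless graph with three types of edges, namely
lines `u — v`, arrows `u → v` and arcs `u ↔ v`. Edges of different types between the same two
vertices are allowed. -/
structure MixedGraph (V : Type*) where
  line : V → V → Prop
  arrow : V → V → Prop
  arc : V → V → Prop
  line_symm : ∀ u v, line u v → line v u
  arc_symm : ∀ u v, arc u v → arc v u
  line_irrefl : ∀ u, ¬ line u u
  arrow_irrefl : ∀ u, ¬ arrow u u
  arc_irrefl : ∀ u, ¬ arc u u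

/-- The type of an edge, as it is traversed by a walk: `—`, `→`, `←` or `↔`. -/
inductive EdgeKind
  | line
  | forward
  | backward
  | arc

/-- The edge has an arrowhead at the vertex that the walk reaches through it. -/
def EdgeKind.HeadAtTarget (e : EdgeKind) : Prop :=
  e = .forward ∨ e = .arc

/-- The edge has an arrowhead at the vertex from which the walk traverses it. -/
def EdgeKind.HeadAtSource (e : EdgeKind) : Prop :=
  e = .backward ∨ e = .arc

namespace MixedGraph

variable {V : Type*}

/-- `G` has an edge of the type `e` from `u` to `v`. -/
def HasEdge (G : MixedGraph V) (e : EdgeKind) (u v : V) : Prop :=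
  match e with
  | .line => G.line u v
  | .forward => G.arrow u v
  | .backward => G.arrow v u
  | .arc => G.arc u v

/-- A chain mixed graph is a mixed graph without semi-directed cycles: there is no closed walk
that consists of lines and of arrows which all point in the direction of the walk, and that
contains at least one arrow. -/
def IsChainMixed (G : MixedGraph V) : Prop :=
  ∀ u v, G.arrow u v → ¬ Relation.ReflTransGen (fun x y => G.line x y ∨ G.arrow x y) v u

/-- A walk `⟨x 0, e 0, x 1, e 1, …, e (len - 1), x len⟩` in `G`. (The values of `x` beyond `len`
and of `e` from `len` on are irrelevant.) -/
structure Walk (G : MixedGraph V) where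
  len : ℕ
  vert : ℕ → V
  edge : ℕ → EdgeKind
  valid : ∀ m < len, G.HasEdge (edge m) (vert m) (vert (m + 1))

namespace Walk

variable {G : MixedGraph V}

/-- The positions `p, …, q` form a section of the walk: a maximal subwalk all of whose edges are
lines (it may be a single vertex). -/
def IsSection (w : G.Walk) (p q : ℕ) : Prop :=
  p ≤ q ∧ q ≤ w.len ∧ (∀ m, p ≤ m → m < q → w.edge m = .line) ∧
    (0 < p → w.edge (p - 1) ≠ .line) ∧ (q < w.len → w.edge q ≠ .line)

/-- The section `p, …, q` is a collider section: it is entered and left through edges of the walk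
that have arrowheads at the section. In particular it contains neither end of the walk. -/
def IsColliderSection (w : G.Walk) (p q : ℕ) : Prop :=
  w.IsSection p q ∧ 0 < p ∧ q < w.len ∧
    (w.edge (p - 1)).HeadAtTarget ∧ (w.edge q).HeadAtSource

/-- The walk is connecting given `C`: every collider section intersects `C` and every other
section is disjoint from `C`. -/
def IsConnecting (w : G.Walk) (C : Set V) : Prop :=
  (∀ p q, w.IsColliderSection p q → ∃ r, p ≤ r ∧ r ≤ q ∧ w.vert r ∈ C) ∧
  (∀ p q, w.IsSection p q → ¬ w.IsColliderSection p q → ∀ r, p ≤ r → r ≤ q → w.vert r ∉ C)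

end Walk

/-- `A` and `B` are separated by `C` in `G`: there is no connecting walk given `C` between a
vertex of `A` and a vertex of `B`. -/
def Separated (G : MixedGraph V) (A B C : Set V) : Prop :=
  ¬ ∃ w : G.Walk, w.vert 0 ∈ A ∧ w.vert w.len ∈ B ∧ w.IsConnecting C

/-- Two graphs are Markov equivalent if they induce the same independence model. -/
def MarkovEquiv (G H : MixedGraph V) : Prop :=
  ∀ A B C : Set V, Disjoint A B → Disjoint A C → Disjoint B C →
    (G.Separated A B C ↔ H.Separated A B C)

/-- The undirected graph (all edges are lines) with the adjacencies of `S`. -/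
def undirected (S : SimpleGraph V) : MixedGraph V where
  line := S.Adj
  arrow _ _ := False
  arc _ _ := False
  line_symm _ _ h := h.symm
  arc_symm _ _ h := h
  line_irrefl _ h := S.irrefl h
  arrow_irrefl _ h := h
  arc_irrefl _ h := h

/-- The bidirected graph (all edges are arcs) with the adjacencies of `S`. -/
def bidirected (S : SimpleGraph V) : MixedGraph V where
  line _ _ := False
  arrow _ _ := False
  arc := S.Adj
  line_symm _ _ h := h
  arc_symm _ _ h := h.symm
  line_irrefl _ h := h
  arrow_irrefl _ h := h
  arc_irrefl _ h := S.irrefl h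

end MixedGraph

/-! ### Conditional independence and faithfulness -/

/-- For a distribution `P` of a random vector `(X_v)_{v ∈ V}`: `X_A` and `X_B` are conditionally
independent given `X_C`. (`cylinderEvents A` is the σ-algebra generated by the coordinates
in `A`.) -/
def CondIndepCoords {V 𝒳 : Type*} [Finite V] [MeasurableSpace 𝒳] [StandardBorelSpace 𝒳]
    (P : Measure (V → 𝒳)) [IsProbabilityMeasure P] (A B C : Set V) : Prop :=
  CondIndep (cylinderEvents (X := fun _ : V => 𝒳) C) (cylinderEvents (X := fun _ : V => 𝒳) A)
    (cylinderEvents (X := fun _ : V => 𝒳) B) cylinderEvents_le_pi P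

/-- `P` is faithful to `G`: the independence model induced by `P` equals the one induced
by `G`. -/
def IsFaithful {V 𝒳 : Type*} [Finite V] [MeasurableSpace 𝒳] [StandardBorelSpace 𝒳]
    (P : Measure (V → 𝒳)) [IsProbabilityMeasure P] (G : MixedGraph V) : Prop :=
  ∀ A B C : Set V, Disjoint A B → Disjoint A C → Disjoint B C →
    (G.Separated A B C ↔ CondIndepCoords P A B C)

/-! ### Random networks -/

/-- The dyads of a node set `N`: the unordered pairs of distinct nodes. -/
abbrev Dyad (N : Type*) : Type _ := (⊤ : SimpleGraph N).edgeSet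

/-- The dyad with the endpoints `i` and `j`. -/
def dyad {N : Type*} (i j : N) (h : i ≠ j) : Dyad N := ⟨s(i, j), h⟩

/-- The dyad `ij` is mapped to `π(i)π(j)`. -/
def Dyad.relabel {N : Type*} (π : Equiv.Perm N) (d : Dyad N) : Dyad N :=
  ⟨Sym2.map π d, by
    obtain ⟨d, hd⟩ := d
    induction d with
    | h i j => simpa using hd⟩

/-- The distribution `P` of a random network is exchangeable: it is invariant under relabeling of
the nodes. -/
def IsExchangeable {N 𝒳 : Type*} [MeasurableSpace 𝒳] (P : Measure (Dyad N → 𝒳)) : Prop :=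
  ∀ π : Equiv.Perm N, P.map (fun x d => x (d.relabel π)) = P

/-- The incidence graph: the line graph of the complete graph on the node set. -/
abbrev incidenceGraph (N : Type*) : SimpleGraph (Dyad N) := (⊤ : SimpleGraph N).lineGraph

/-- The six regimes. -/
inductive Regime
  | empty
  | undirectedIncidence
  | bidirectedIncidence
  | undirectedCompl
  | bidirectedCompl
  | complete

/-- The graph that represents a regime: the empty graph, `L₋(n)`, `L_↔(n)`, `Lᶜ₋(n)`, `Lᶜ_↔(n)`,
the complete graph. -/
def Regime.graph (N : Type*) : Regime → MixedGraph (Dyad N)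
  | .empty => .undirected ⊥
  | .undirectedIncidence => .undirected (incidenceGraph N)
  | .bidirectedIncidence => .bidirected (incidenceGraph N)
  | .undirectedCompl => .undirected (incidenceGraph N)ᶜ
  | .bidirectedCompl => .bidirected (incidenceGraph N)ᶜ
  | .complete => .undirected ⊤

/-! ### The test -/

/-- `X_a` and `X_b` are conditionally independent given `X_C`, where `C` contains neither `a`
nor `b`. -/
def PairIndep {V 𝒳 : Type*} [Finite V] [MeasurableSpace 𝒳] [StandardBorelSpace 𝒳]
    (P : Measure (V → 𝒳)) [IsProbabilityMeasure P] (a b : V) (C : Set V) : Prop :=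
  a ∉ C ∧ b ∉ C ∧ CondIndepCoords P {a} {b} C

/-- `TestOutputs P ij kl ik lm r`: the test, run on `P` with the dyads `ij`, `kl`, `ik`, `lm`, can
answer `r`. In the second and in the third case the answer is read off from whichever
separating set `C` was found, so a priori the test might have several answers. -/
inductive TestOutputs {V 𝒳 : Type*} [Finite V] [MeasurableSpace 𝒳] [StandardBorelSpace 𝒳]
    (P : Measure (V → 𝒳)) [IsProbabilityMeasure P] (ij kl ik lm : V) : Regime → Prop
  | empty (C C' : Set V) : PairIndep P ij kl C → PairIndep P ij ik C' →
      TestOutputs P ij kl ik lm .empty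
  | undirectedIncidence (C : Set V) : PairIndep P ij kl C → (∀ C', ¬ PairIndep P ij ik C') →
      ik ∈ C → TestOutputs P ij kl ik lm .undirectedIncidence
  | bidirectedIncidence (C : Set V) : PairIndep P ij kl C → (∀ C', ¬ PairIndep P ij ik C') →
      ik ∉ C → TestOutputs P ij kl ik lm .bidirectedIncidence
  | undirectedCompl (C' : Set V) : (∀ C, ¬ PairIndep P ij kl C) → PairIndep P ij ik C' →
      lm ∈ C' → TestOutputs P ij kl ik lm .undirectedCompl
  | bidirectedCompl (C' : Set V) : (∀ C, ¬ PairIndep P ij kl C) → PairIndep P ij ik C' →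
      lm ∉ C' → TestOutputs P ij kl ik lm .bidirectedCompl
  | complete : (∀ C, ¬ PairIndep P ij kl C) → (∀ C', ¬ PairIndep P ij ik C') →
      TestOutputs P ij kl ik lm .complete

/-! Faithfulness turns exchangeability into a symmetry of `G`: relabelling the nodes preserves the
separations between single dyads (`preserves_relabelEquiv`). All incident pairs of dyads are alike,
and so are all disjoint pairs. The inseparable pairs therefore form the empty graph, the incidence
graph, its complement or the complete graph, and the two independence queries tell which.

In the first and last case nothing else is to be decided. In the other two let `S` be the
inseparability graph and `a, c, b` an unshielded triple of `S`. Every separator of `a` and `b`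
contains `c` if `c` is anterior to `a` or `b`, and none does otherwise (`connects_of_mem_antPair`,
`connects_of_notMem_antPair`); so the answer does not depend on the separator. Both rest on the fact
that `a` and `b` are inseparable iff a collider walk inside their anteriors joins them
(`inseparable_iff`). Relabelling also permutes the unshielded triples transitively, so they all
behave alike.

If the middle is never anterior to an end, then no vertex is anterior to a neighbour in `S`; `G` has
no lines or arrows and equals `bidirected S` (`eq_bidirected`). If it always is, the combinatorics
of dyads (`Rigid`) yields a nonadjacent pair `x, y` to which all vertices are anterior
(`exists_antPair_eq_univ`). Colliders then never block a walk between `x` and `y`, so separation of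
`x` and `y` in `G` is separation in `S`, and symmetry carries this to all nonadjacent pairs
(`markovEquiv_undirected`). -/

/-! ### Walks as runs of an automaton -/

namespace MixedGraph

variable {V : Type*}

/-- The state of a walk: the current vertex, whether the current section was entered through an
arrowhead, and whether the current section has met the conditioning set so far. -/
structure WalkState (V : Type*) where
  vert : V
  head : Prop
  hit : Prop

/-- One step of a walk all of whose completed sections are compatible with `C`. -/
inductive Step (G : MixedGraph V) (C : Set V) : WalkState V → WalkState V → Prop
  | line {u v : V} {h t : Prop} : G.line u v → Step G C ⟨u, h, t⟩ ⟨v, h, t ∨ v ∈ C⟩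
  -- Leaving through a tail completes a non-collider section, which must not be hit. Leaving through
  -- an arrowhead completes a collider section exactly if `h`, and it must be hit exactly then.
  | forward {u v : V} {h t : Prop} : G.arrow u v → ¬ t → Step G C ⟨u, h, t⟩ ⟨v, True, v ∈ C⟩
  | backward {u v : V} {h t : Prop} : G.arrow v u → (t ↔ h) →
      Step G C ⟨u, h, t⟩ ⟨v, False, v ∈ C⟩
  | arc {u v : V} {h t : Prop} : G.arc u v → (t ↔ h) → Step G C ⟨u, h, t⟩ ⟨v, True, v ∈ C⟩

/-- The state `s` can be reached by a walk from `a`. -/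
def Reach (G : MixedGraph V) (C : Set V) (a : V) (s : WalkState V) : Prop :=
  Relation.ReflTransGen (G.Step C) ⟨a, False, a ∈ C⟩ s

/-- There is a connecting walk from `a` to `b` given `C`. -/
def Connects (G : MixedGraph V) (C : Set V) (a b : V) : Prop :=
  ∃ h, G.Reach C a ⟨b, h, False⟩

variable {G : MixedGraph V} {C : Set V} {a b : V}

/-- The flags of a state are propositions, so states are matched up to `↔` through `propext`. -/
theorem Step.congr_right {s : WalkState V} {v : V} {h h' t t' : Prop}
    (hs : G.Step C s ⟨v, h, t⟩) (hh : h ↔ h') (ht : t ↔ t') : G.Step C s ⟨v, h', t'⟩ := by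
  obtain rfl := propext hh
  obtain rfl := propext ht
  exact hs

theorem Reach.congr {v : V} {h h' t t' : Prop}
    (hs : G.Reach C a ⟨v, h, t⟩) (hh : h ↔ h') (ht : t ↔ t') : G.Reach C a ⟨v, h', t'⟩ := by
  obtain rfl := propext hh
  obtain rfl := propext ht
  exact hs

/-- An edge that is not a line can be traversed if the section that it leaves is compatible with
the conditioning set. -/
theorem Step.of_hasEdge {e : EdgeKind} {u v : V} {h t : Prop} (he : G.HasEdge e u v)
    (hl : e ≠ .line) (hc : t ↔ h ∧ e.HeadAtSource) :
    G.Step C ⟨u, h, t⟩ ⟨v, e.HeadAtTarget, v ∈ C⟩ := by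
  cases e with
  | line => exact absurd rfl hl
  | forward =>
    exact (Step.forward he (by simp [hc, EdgeKind.HeadAtSource])).congr_right
      (by simp [EdgeKind.HeadAtTarget]) Iff.rfl
  | backward =>
    exact (Step.backward he (by simp [hc, EdgeKind.HeadAtSource])).congr_right
      (by simp [EdgeKind.HeadAtTarget]) Iff.rfl
  | arc =>
    exact (Step.arc he (by simp [hc, EdgeKind.HeadAtSource])).congr_right
      (by simp [EdgeKind.HeadAtTarget]) Iff.rfl

theorem Step.exists_hasEdge {s s' : WalkState V} (hs : G.Step C s s') :
    ∃ e, G.HasEdge e s.vert s'.vert ∧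
      ((e = .line ∧ s'.head = s.head ∧ s'.hit = (s.hit ∨ s'.vert ∈ C)) ∨
        (e ≠ .line ∧ (s.hit ↔ s.head ∧ e.HeadAtSource) ∧ (s'.head ↔ e.HeadAtTarget) ∧
          s'.hit = (s'.vert ∈ C))) := by
  cases hs with
  | line h => exact ⟨.line, h, .inl ⟨rfl, rfl, rfl⟩⟩
  | forward h ht =>
    exact ⟨.forward, h, .inr ⟨by simp, by simp [ht, EdgeKind.HeadAtSource],
      by simp [EdgeKind.HeadAtTarget], rfl⟩⟩
  | backward h ht =>
    exact ⟨.backward, h, .inr ⟨by simp, by simp [ht, EdgeKind.HeadAtSource],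
      by simp [EdgeKind.HeadAtTarget], rfl⟩⟩
  | arc h ht =>
    exact ⟨.arc, h, .inr ⟨by simp, by simp [ht, EdgeKind.HeadAtSource],
      by simp [EdgeKind.HeadAtTarget], rfl⟩⟩

namespace Walk

/-- In the walk `w` up to the position `len`, the last section starts at the position `p`. -/
def LastStart (w : G.Walk) (len p : ℕ) : Prop :=
  p ≤ len ∧ (∀ m, p ≤ m → m < len → w.edge m = .line) ∧ (0 < p → w.edge (p - 1) ≠ .line)

theorem IsConnecting.connects {w : G.Walk} (hw : w.IsConnecting C) :
    G.Connects C (w.vert 0) (w.vert w.len) := by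
  -- The flags after `n` edges describe the section that starts at `p` and is still open.
  have key : ∀ n ≤ w.len, ∃ p, w.LastStart n p ∧ G.Reach C (w.vert 0)
      ⟨w.vert n, 0 < p ∧ (w.edge (p - 1)).HeadAtTarget, ∃ r, p ≤ r ∧ r ≤ n ∧ w.vert r ∈ C⟩ := by
    intro n
    induction n with
    | zero =>
      intro _
      refine ⟨0, ⟨le_rfl, by simp, by simp⟩, ?_⟩
      refine Reach.congr (h := False) (t := w.vert 0 ∈ C) Relation.ReflTransGen.refl (by simp) ?_
      constructor
      · intro h; exact ⟨0, le_rfl, le_rfl, h⟩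
      · rintro ⟨r, -, hr, h⟩
        obtain rfl : r = 0 := by omega
        exact h
    | succ n ih =>
      intro hn
      obtain ⟨p, ⟨hp, hlines, hstart⟩, hR⟩ := ih (by omega)
      by_cases hl : w.edge n = .line
      · refine ⟨p, ⟨by omega, fun m h1 h2 => ?_, hstart⟩, ?_⟩
        · obtain rfl | h := (Nat.lt_succ_iff_lt_or_eq.1 h2).symm
          · exact hl
          · exact hlines m h1 h
        · have hv := w.valid n (by omega)
          rw [hl] at hv
          refine Reach.congr (Relation.ReflTransGen.tail hR (Step.line hv)) Iff.rfl ?_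
          constructor
          · rintro (⟨r, h1, h2, h3⟩ | h)
            · exact ⟨r, h1, by omega, h3⟩
            · exact ⟨n + 1, by omega, le_rfl, h⟩
          · rintro ⟨r, h1, h2, h3⟩
            obtain rfl | h := (Nat.le_succ_iff_eq_or_le.1 h2)
            · exact .inr h3
            · exact .inl ⟨r, h1, h, h3⟩
      · refine ⟨n + 1, ⟨le_rfl, fun m h1 h2 => by omega, by simpa using hl⟩, ?_⟩
        have hsec : w.IsSection p n := ⟨hp, by omega, hlines, hstart, fun _ => hl⟩
        refine Reach.congr (Relation.ReflTransGen.tail hR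
          (Step.of_hasEdge (w.valid n (by omega)) hl ?_)) (by simp) ?_
        · constructor
          · rintro ⟨r, h1, h2, h3⟩
            by_contra hcon
            exact hw.2 p n hsec (fun hcol => hcon ⟨⟨hcol.2.1, hcol.2.2.2.1⟩, hcol.2.2.2.2⟩)
              r h1 h2 h3
          · rintro ⟨⟨h1, h2⟩, h3⟩
            exact hw.1 p n ⟨hsec, h1, by omega, h2, h3⟩
        · constructor
          · intro h; exact ⟨n + 1, le_rfl, le_rfl, h⟩
          · rintro ⟨r, h1, h2, h3⟩
            obtain rfl : r = n + 1 := by omega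
            exact h3
  obtain ⟨p, ⟨hp, hlines, hstart⟩, hR⟩ := key w.len le_rfl
  refine ⟨_, hR.congr Iff.rfl ?_⟩
  simp only [iff_false]
  rintro ⟨r, h1, h2, h3⟩
  exact hw.2 p w.len ⟨hp, le_rfl, hlines, hstart, by simp⟩
    (fun h => lt_irrefl _ h.2.2.1) r h1 h2 h3

/-- Extension of a walk by an edge. -/
def snoc (w : G.Walk) (e : EdgeKind) (v : V) (h : G.HasEdge e (w.vert w.len) v) : G.Walk where
  len := w.len + 1
  vert m := if m ≤ w.len then w.vert m else v
  edge m := if m < w.len then w.edge m else e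
  valid m hm := by
    by_cases h1 : m < w.len
    · simpa [h1, h1.le, Nat.succ_le_of_lt h1] using w.valid m h1
    · obtain rfl : m = w.len := by omega
      simpa using h

/-- The condition on sections is imposed only if `q < w.len`: the last section is still open, and
its fate is stored in `head` and `hit`. -/
theorem exists_of_reach {s : WalkState V} (hs : G.Reach C a s) :
    ∃ w : G.Walk, w.vert 0 = a ∧ w.vert w.len = s.vert ∧ ∃ p, w.LastStart w.len p ∧
      (s.head ↔ 0 < p ∧ (w.edge (p - 1)).HeadAtTarget) ∧
      (s.hit ↔ ∃ r, p ≤ r ∧ r ≤ w.len ∧ w.vert r ∈ C) ∧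
      ∀ p q, w.IsSection p q → q < w.len →
        (w.IsColliderSection p q ↔ ∃ r, p ≤ r ∧ r ≤ q ∧ w.vert r ∈ C) := by
  induction hs with
  | refl =>
    refine ⟨⟨0, fun _ => a, fun _ => .line, by simp⟩, rfl, rfl, 0, ⟨le_rfl, by simp, by simp⟩,
      by simp, ?_, by simp⟩
    exact ⟨fun h => ⟨0, le_rfl, le_rfl, h⟩, fun ⟨_, _, _, h⟩ => h⟩
  | @tail s s' _ hst ih =>
    obtain ⟨w, h0, hlen, p, ⟨hp, hlines, hstart⟩, hhead, hhit, hsec⟩ := ih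
    obtain ⟨e, he, hcase⟩ := hst.exists_hasEdge
    rw [← hlen] at he
    have hvert : ∀ m ≤ w.len, (w.snoc e _ he).vert m = w.vert m := fun m hm => by simp [snoc, hm]
    have hvert' : (w.snoc e _ he).vert (w.len + 1) = s'.vert := by simp [snoc]
    have hedge : ∀ m < w.len, (w.snoc e _ he).edge m = w.edge m := fun m hm => by simp [snoc, hm]
    have hedge' : (w.snoc e _ he).edge w.len = e := by simp [snoc]
    have hl : (w.snoc e _ he).len = w.len + 1 := rfl
    have hpred : ∀ r, 0 < r → r ≤ w.len → (w.snoc e _ he).edge (r - 1) = w.edge (r - 1) :=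
      fun r h1 h2 => hedge _ (by omega)
    have hhit' : ∀ p q, q ≤ w.len → ((∃ r, p ≤ r ∧ r ≤ q ∧ (w.snoc e _ he).vert r ∈ C) ↔
        ∃ r, p ≤ r ∧ r ≤ q ∧ w.vert r ∈ C) := by
      intro p q hq
      refine exists_congr fun r => and_congr_right fun _ => and_congr_right fun h2 => ?_
      rw [hvert r (h2.trans hq)]
    have hold : ∀ p' q, (w.snoc e _ he).IsSection p' q → q < w.len →
        ((w.snoc e _ he).IsColliderSection p' q ↔
          ∃ r, p' ≤ r ∧ r ≤ q ∧ (w.snoc e _ he).vert r ∈ C) := by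
      intro p' q hs hq
      have hs' : w.IsSection p' q := by
        obtain ⟨h1, h2, h3, h4, h5⟩ := hs
        refine ⟨h1, hq.le, fun m a1 a2 => ?_, fun h => ?_, fun h => ?_⟩
        · rw [← hedge m (by omega)]; exact h3 m a1 a2
        · rw [← hpred p' h (by omega)]; exact h4 h
        · rw [← hedge q hq]; exact h5 (by omega)
      rw [hhit' p' q hq.le, ← hsec p' q hs' hq]
      constructor
      · rintro ⟨-, a1, a2, a3, a4⟩
        rw [hpred p' a1 (by have := hs.1; omega)] at a3
        rw [hedge q hq] at a4
        exact ⟨hs', a1, hq, a3, a4⟩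
      · rintro ⟨-, a1, a2, a3, a4⟩
        rw [← hpred p' a1 (by have := hs.1; omega)] at a3
        rw [← hedge q hq] at a4
        exact ⟨hs, a1, by omega, a3, a4⟩
    rcases hcase with ⟨rfl, hh, ht⟩ | ⟨hne, hc, hh, ht⟩
    · refine ⟨w.snoc _ _ he, by rw [hvert 0 (by omega), h0], hvert', p,
        ⟨by omega, fun m a1 a2 => ?_, fun h => ?_⟩, ?_, ?_, ?_⟩
      · by_cases hm : m < w.len
        · rw [hedge m hm]; exact hlines m a1 hm
        · obtain rfl : m = w.len := by omega
          exact hedge'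
      · rw [hpred p h hp]; exact hstart h
      · rw [hh, hhead]
        refine and_congr_right fun h => ?_
        rw [hpred p h hp]
      · rw [ht, hhit, ← hhit' p w.len le_rfl]
        constructor
        · rintro (⟨r, a1, a2, a3⟩ | h)
          · exact ⟨r, a1, by omega, a3⟩
          · exact ⟨w.len + 1, by omega, le_rfl, by rwa [hvert']⟩
        · rintro ⟨r, a1, a2, a3⟩
          by_cases hr : r ≤ w.len
          · exact .inl ⟨r, a1, hr, a3⟩
          · obtain rfl : r = w.len + 1 := by omega
            exact .inr (by rwa [hvert'] at a3)
      · intro p' q hs hq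
        by_cases hq' : q < w.len
        · exact hold p' q hs hq'
        · obtain rfl : q = w.len := by omega
          exact absurd hedge' (hs.2.2.2.2 hq)
    · refine ⟨w.snoc _ _ he, by rw [hvert 0 (by omega), h0], hvert', w.len + 1,
        ⟨le_rfl, fun m a1 a2 => by omega, fun _ => ?_⟩, ?_, ?_, ?_⟩
      · simpa [hedge'] using hne
      · rw [hh]; simp [hedge']
      · rw [ht]
        constructor
        · intro h; exact ⟨w.len + 1, le_rfl, le_rfl, by rwa [hvert']⟩
        · rintro ⟨r, a1, a2, a3⟩
          obtain rfl : r = w.len + 1 := by omega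
          rwa [hvert'] at a3
      · intro p' q hs hq
        by_cases hq' : q < w.len
        · exact hold p' q hs hq'
        · obtain rfl : q = w.len := by omega
          -- Two sections with the same end have the same start: otherwise the edge before the later
          -- start would be a line.
          obtain rfl : p' = p := by
            obtain ⟨b1, b2, b3, b4, b5⟩ := hs
            rcases lt_trichotomy p' p with h | h | h
            · have := b3 (p - 1) (by omega) (by omega)
              rw [hpred p (by omega) hp] at this
              exact absurd this (hstart (by omega))
            · exact h
            · have := hlines (p' - 1) (by omega) (by omega)
              rw [← hpred p' (by omega) b1] at this
              exact absurd this (b4 (by omega))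
          rw [hhit' p' w.len le_rfl, ← hhit, hc, hhead]
          constructor
          · rintro ⟨-, a1, -, a3, a4⟩
            rw [hpred p' a1 hp] at a3
            rw [hedge'] at a4
            exact ⟨⟨a1, a3⟩, a4⟩
          · rintro ⟨⟨a1, a3⟩, a4⟩
            refine ⟨hs, a1, hq, ?_, ?_⟩
            · rwa [hpred p' a1 hp]
            · rwa [hedge']

end Walk

theorem Connects.exists_walk (h : G.Connects C a b) :
    ∃ w : G.Walk, w.vert 0 = a ∧ w.vert w.len = b ∧ w.IsConnecting C := by
  obtain ⟨h, hR⟩ := h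
  obtain ⟨w, h0, hlen, p, hlast, -, hhit, hsec⟩ := Walk.exists_of_reach hR
  refine ⟨w, h0, hlen, fun p q hc => (hsec p q hc.1 hc.2.2.1).1 hc, ?_⟩
  intro p' q hs hnc r h1 h2 h3
  by_cases hq : q < w.len
  · exact hnc ((hsec p' q hs hq).2 ⟨r, h1, h2, h3⟩)
  · obtain rfl : q = w.len := le_antisymm hs.2.1 (not_lt.1 hq)
    obtain rfl : p' = p := by
      obtain ⟨b1, b2, b3, b4, b5⟩ := hs
      obtain ⟨c1, c2, c3⟩ := hlast
      rcases lt_trichotomy p' p with h | h | h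
      · exact absurd (b3 (p - 1) (by omega) (by omega)) (c3 (by omega))
      · exact h
      · exact absurd (c2 (p' - 1) (by omega) (by omega)) (b4 (by omega))
    exact hhit.2 ⟨r, h1, h2, h3⟩

theorem separated_iff {A B : Set V} :
    G.Separated A B C ↔ ∀ a ∈ A, ∀ b ∈ B, ¬ G.Connects C a b := by
  constructor
  · intro h a ha b hb hc
    obtain ⟨w, h0, hl, hw⟩ := hc.exists_walk
    exact h ⟨w, h0 ▸ ha, hl ▸ hb, hw⟩
  · rintro h ⟨w, h0, hl, hw⟩
    exact h _ h0 _ hl hw.connects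

end MixedGraph

/-! ### Anteriors and collider walks -/

namespace MixedGraph

variable {V : Type*} {G : MixedGraph V} {C : Set V} {a b : V}

/-- `u` is anterior to `v`: there is a walk from `u` to `v` made of lines and of arrows that point
towards `v`. -/
def Ant (G : MixedGraph V) (u v : V) : Prop :=
  Relation.ReflTransGen (fun x y => G.line x y ∨ G.arrow x y) u v

/-- An edge with an arrowhead at `u` joins `a` and `u`. -/
def Into (G : MixedGraph V) (a u : V) : Prop := G.arrow a u ∨ G.arc a u

/-- `u` and `v` are joined by lines and arcs inside `D`. -/
def District (G : MixedGraph V) (D : Set V) (u v : V) : Prop :=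
  Relation.ReflTransGen (fun x y => x ∈ D ∧ y ∈ D ∧ (G.line x y ∨ G.arc x y)) u v

/-- There is a walk from `a` to `v` that enters all sections but the first through arrowheads,
such that all sections but the first and the last are collider sections, the first section
consists of `a`, and all other vertices are in `D`. -/
def HeadTo (G : MixedGraph V) (D : Set V) (a v : V) : Prop :=
  ∃ u ∈ D, G.Into a u ∧ G.District D u v

/-- `a` and `b` are joined by an edge. -/
def EdgeAdj (G : MixedGraph V) (a b : V) : Prop := ∃ e, G.HasEdge e a b

/-- `a` and `b` are joined by a walk all of whose inner sections are collider sections inside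
`D`. -/
def ColliderWalk (G : MixedGraph V) (D : Set V) (a b : V) : Prop :=
  G.EdgeAdj a b ∨ ∃ v, G.HeadTo D a v ∧ G.Into b v

theorem Ant.trans {u v w : V} (h : G.Ant u v) (h' : G.Ant v w) : G.Ant u w :=
  Relation.ReflTransGen.trans h h'

theorem Ant.refl (u : V) : G.Ant u u := Relation.ReflTransGen.refl

theorem Ant.of_line {u v : V} (h : G.line u v) : G.Ant u v :=
  Relation.ReflTransGen.single (.inl h)

theorem Ant.of_arrow {u v : V} (h : G.arrow u v) : G.Ant u v :=
  Relation.ReflTransGen.single (.inr h)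

theorem EdgeAdj.symm (h : G.EdgeAdj a b) : G.EdgeAdj b a := by
  obtain ⟨e, he⟩ := h
  cases e with
  | line => exact ⟨.line, G.line_symm _ _ he⟩
  | forward => exact ⟨.backward, he⟩
  | backward => exact ⟨.forward, he⟩
  | arc => exact ⟨.arc, G.arc_symm _ _ he⟩

theorem District.symm {D : Set V} {u v : V} (h : G.District D u v) : G.District D v u := by
  have : Std.Symm fun x y => x ∈ D ∧ y ∈ D ∧ (G.line x y ∨ G.arc x y) :=
    ⟨fun _ _ h => ⟨h.2.1, h.1, h.2.2.imp (G.line_symm _ _) (G.arc_symm _ _)⟩⟩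
  exact Relation.ReflTransGen.stdSymm.symm _ _ h

theorem District.mono {D D' : Set V} (hD : D ⊆ D') {u v : V} (h : G.District D u v) :
    G.District D' u v :=
  Relation.ReflTransGen.mono (fun _ _ h => ⟨hD h.1, hD h.2.1, h.2.2⟩) _ _ h

theorem District.mem {D : Set V} {u v : V} (h : G.District D u v) (hu : u ∈ D) : v ∈ D := by
  induction h with
  | refl => exact hu
  | tail _ h _ => exact h.2.1

theorem HeadTo.mono {D D' : Set V} (hD : D ⊆ D') {u v : V} (h : G.HeadTo D u v) :
    G.HeadTo D' u v := by
  obtain ⟨w, hw, h1, h2⟩ := h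
  exact ⟨w, hD hw, h1, h2.mono hD⟩

theorem HeadTo.mem {D : Set V} {u v : V} (h : G.HeadTo D u v) : v ∈ D := by
  obtain ⟨w, hw, _, h2⟩ := h
  exact h2.mem hw

theorem ColliderWalk.mono {D D' : Set V} (hD : D ⊆ D') {u v : V} (h : G.ColliderWalk D u v) :
    G.ColliderWalk D' u v :=
  h.imp_right fun ⟨w, h1, h2⟩ => ⟨w, h1.mono hD, h2⟩

theorem ColliderWalk.symm {D : Set V} {u v : V} (h : G.ColliderWalk D u v) :
    G.ColliderWalk D v u := by
  rcases h with h | ⟨w, ⟨x, hx, h1, h2⟩, h3⟩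
  · exact .inl h.symm
  · exact .inr ⟨x, ⟨w, h2.mem hx, h3, h2.symm⟩, h1⟩

theorem HeadTo.of_into {D : Set V} {u v : V} (h : G.Into u v) (hv : v ∈ D) : G.HeadTo D u v :=
  ⟨v, hv, h, .refl⟩

theorem HeadTo.tail {D : Set V} {u v w : V} (h : G.HeadTo D u v) (hw : w ∈ D)
    (hvw : G.line v w ∨ G.arc v w) : G.HeadTo D u w := by
  have hv := h.mem
  obtain ⟨x, hx, h1, h2⟩ := h
  exact ⟨x, hx, h1, h2.tail ⟨hv, hw, hvw⟩⟩

/-! ### Connecting walks from collider walks -/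

theorem Reach.hit_of_mem {s : WalkState V} (h : G.Reach C a s) (hs : s.vert ∈ C) : s.hit := by
  cases h with
  | refl => exact hs
  | tail _ h =>
    cases h with
    | line _ => exact .inr hs
    | forward _ _ => exact hs
    | backward _ _ => exact hs
    | arc _ _ => exact hs

/-- The vertices from which a walk can be made to meet `C`, or one of its ends `a` and `b`. -/
def AntSet (G : MixedGraph V) (C : Set V) (a b : V) : Set V :=
  {v | (∃ c ∈ C, G.Ant v c) ∨ G.Ant v a ∨ G.Ant v b}

/-- Follow the anterior walk until the section is hit, then return. If only lines are used, the
section of `v` has been enlarged and hit, and `h` survives. Otherwise the return runs against an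
arrow, and the section of `v` is then entered through a tail and not hit. -/
theorem Reach.detour {v c : V} (hc : c ∈ C) (hv : G.Ant v c) : ∀ h t, G.Reach C a ⟨v, h, t⟩ →
    G.Reach C a ⟨v, h, True⟩ ∨ G.Reach C a ⟨v, False, False⟩ := by
  induction hv using Relation.ReflTransGen.head_induction_on with
  | refl =>
    intro h t hr
    have : t := hr.hit_of_mem hc
    exact .inl (hr.congr Iff.rfl (by simp [this]))
  | @head v w hvw _ ih =>
    intro h t hr
    by_cases ht : t
    · exact .inl (hr.congr Iff.rfl (by simp [ht]))
    have hvC : v ∉ C := fun hm => ht (hr.hit_of_mem hm)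
    rcases hvw with hl | harr
    · rcases ih _ _ (hr.tail (.line hl)) with h1 | h1
      · exact .inl (Reach.congr (h1.tail (.line (G.line_symm _ _ hl))) Iff.rfl (by simp))
      · exact .inr (Reach.congr (h1.tail (.line (G.line_symm _ _ hl))) Iff.rfl (by simp [hvC]))
    · rcases ih _ _ (hr.tail (.forward harr ht)) with h1 | h1
      · exact .inr (Reach.congr (h1.tail (.backward harr Iff.rfl)) Iff.rfl (by simp [hvC]))
      · exact .inr (Reach.congr (h1.tail (.backward harr Iff.rfl)) Iff.rfl (by simp [hvC]))

/-- The walk to `v` is built afresh, from `a` against the anterior walk. It never meets `C` and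
enters no section through an arrowhead. -/
theorem Reach.of_ant_start {v : V} (hv : G.Ant v a) (hC : ¬ ∃ c ∈ C, G.Ant v c) :
    G.Reach C a ⟨v, False, False⟩ := by
  induction hv using Relation.ReflTransGen.head_induction_on with
  | refl =>
    have : a ∉ C := fun h => hC ⟨a, h, .refl _⟩
    exact Reach.congr (h := False) (t := a ∈ C) .refl Iff.rfl (by simp [this])
  | @head v w hvw _ ih =>
    have hvC : v ∉ C := fun h => hC ⟨v, h, .refl _⟩
    have h1 := ih fun ⟨c, hc, h⟩ => hC ⟨c, hc, Relation.ReflTransGen.head hvw h⟩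
    rcases hvw with hl | harr
    · exact Reach.congr (h1.tail (.line (G.line_symm _ _ hl))) Iff.rfl (by simp [hvC])
    · exact Reach.congr (h1.tail (.backward harr Iff.rfl)) Iff.rfl (by simp [hvC])

theorem Reach.connects_of_ant {v : V} (hv : G.Ant v b) (hC : ¬ ∃ c ∈ C, G.Ant v c) :
    ∀ h, G.Reach C a ⟨v, h, False⟩ → G.Connects C a b := by
  induction hv using Relation.ReflTransGen.head_induction_on with
  | refl => exact fun h hr => ⟨h, hr⟩
  | @head v w hvw _ ih =>
    intro h hr
    have hC' : ¬ ∃ c ∈ C, G.Ant w c :=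
      fun ⟨c, hc, h⟩ => hC ⟨c, hc, Relation.ReflTransGen.head hvw h⟩
    have hwC : w ∉ C := fun h => hC' ⟨w, h, .refl _⟩
    rcases hvw with hl | harr
    · exact ih hC' _ (Reach.congr (hr.tail (.line hl)) Iff.rfl (by simp [hwC]))
    · exact ih hC' _ (Reach.congr (hr.tail (.forward harr id)) Iff.rfl (by simp [hwC]))

/-- A walk that is at a vertex of `AntSet` can be extended to a connecting walk, or modified such
that it can be continued through an arrowhead at that vertex. -/
theorem Reach.exit {v : V} {h t : Prop} (hr : G.Reach C a ⟨v, h, t⟩) (hv : v ∈ G.AntSet C a b) :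
    G.Connects C a b ∨ G.Reach C a ⟨v, h, True⟩ ∨ G.Reach C a ⟨v, False, False⟩ := by
  by_cases hC : ∃ c ∈ C, G.Ant v c
  · obtain ⟨c, hc, hvc⟩ := hC
    exact .inr (Reach.detour hc hvc _ _ hr)
  by_cases ht : t
  · exact .inr (.inl (hr.congr Iff.rfl (by simp [ht])))
  rcases hv with hv | hv | hv
  · exact absurd hv hC
  · exact .inr (.inr (.of_ant_start hv hC))
  · exact .inl (Reach.connects_of_ant hv hC _ (hr.congr Iff.rfl (by simp [ht])))

theorem Reach.exit_edge {v w : V} {t : Prop} (hr : G.Reach C a ⟨v, True, t⟩)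
    (hv : v ∈ G.AntSet C a b) {e : EdgeKind} (he : G.HasEdge e v w) (hs : e.HeadAtSource) :
    G.Connects C a b ∨ G.Reach C a ⟨w, e.HeadAtTarget, w ∈ C⟩ := by
  have hne : e ≠ .line := by rintro rfl; simp [EdgeKind.HeadAtSource] at hs
  rcases hr.exit hv with h | h | h
  · exact .inl h
  · exact .inr (h.tail (.of_hasEdge he hne (by simp [hs])))
  · exact .inr (h.tail (.of_hasEdge he hne (by simp)))

/-- Only an exit that would create an unhit collider section is obstructed, and `Reach.exit_edge`
repairs it. A line leaves `h'` as it was, hence the proviso `e ≠ .line`. -/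
theorem Reach.hasEdge {v w : V} {h : Prop} (hr : G.Reach C a ⟨v, h, False⟩)
    (hv : v ∈ G.AntSet C a b) {e : EdgeKind} (he : G.HasEdge e v w) :
    G.Connects C a b ∨ ∃ h', G.Reach C a ⟨w, h', w ∈ C⟩ ∧ (e ≠ .line → (h' ↔ e.HeadAtTarget)) := by
  by_cases hl : e = .line
  · subst hl
    exact .inr ⟨h, Reach.congr (hr.tail (.line he)) Iff.rfl (by simp), by simp⟩
  by_cases hc : h ∧ e.HeadAtSource
  · exact (Reach.exit_edge (hr.congr (by simp [hc.1]) Iff.rfl) hv he hc.2).imp_right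
      fun h => ⟨_, h, fun _ => Iff.rfl⟩
  · exact .inr ⟨_, hr.tail (.of_hasEdge he hl (by simp only [hc])), fun _ => Iff.rfl⟩

theorem Reach.headTo {D : Set V} (hD : D ⊆ G.AntSet C a b) {c v : V} {h : Prop}
    (hr : G.Reach C a ⟨c, h, False⟩) (hc : c ∈ G.AntSet C a b) (hv : G.HeadTo D c v) :
    G.Connects C a b ∨ ∃ t, G.Reach C a ⟨v, True, t⟩ := by
  obtain ⟨u, hu, hcu, huv⟩ := hv
  induction huv with
  | refl =>
    rcases hcu with hcu | hcu
    · refine (hr.hasEdge hc (e := .forward) hcu).imp_right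
        fun ⟨h', h1, h2⟩ => ⟨_, h1.congr ?_ Iff.rfl⟩
      simp [h2, EdgeKind.HeadAtTarget]
    · refine (hr.hasEdge hc (e := .arc) hcu).imp_right
        fun ⟨h', h1, h2⟩ => ⟨_, h1.congr ?_ Iff.rfl⟩
      simp [h2, EdgeKind.HeadAtTarget]
  | @tail v w _ hvw ih =>
    obtain ⟨hvD, hwD, hvw⟩ := hvw
    rcases ih with h1 | ⟨t, h1⟩
    · exact .inl h1
    rcases hvw with hl | harc
    · exact .inr ⟨_, h1.tail (.line hl)⟩
    · refine (h1.exit_edge (hD hvD) (e := .arc) harc (by simp [EdgeKind.HeadAtSource])).imp_right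
        fun h => ⟨_, h.congr ?_ Iff.rfl⟩
      simp [EdgeKind.HeadAtTarget]

/-- A walk that ends in a non-collider section can be prolonged by a collider walk. -/
theorem Reach.colliderWalk {D : Set V} (hD : D ⊆ G.AntSet C a b) {c v : V} {h : Prop}
    (hr : G.Reach C a ⟨c, h, False⟩) (hc : c ∈ G.AntSet C a b) (hv : G.ColliderWalk D c v)
    (hvC : v ∉ C) : G.Connects C a b ∨ ∃ h', G.Reach C a ⟨v, h', False⟩ := by
  rcases hv with ⟨e, he⟩ | ⟨w, hcw, hvw⟩
  · exact (hr.hasEdge hc he).imp_right fun ⟨h', h1, _⟩ => ⟨h', h1.congr Iff.rfl (by simp [hvC])⟩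
  · rcases hr.headTo hD hc hcw with h1 | ⟨t, h1⟩
    · exact .inl h1
    rcases hvw with hvw | hvw
    · refine (h1.exit_edge (hD hcw.mem) (e := .backward) hvw
        (by simp [EdgeKind.HeadAtSource])).imp_right fun h => ⟨_, h.congr Iff.rfl (by simp [hvC])⟩
    · refine (h1.exit_edge (hD hcw.mem) (e := .arc) (G.arc_symm _ _ hvw)
        (by simp [EdgeKind.HeadAtSource])).imp_right fun h => ⟨_, h.congr Iff.rfl (by simp [hvC])⟩

theorem Reach.start (ha : a ∉ C) : G.Reach C a ⟨a, False, False⟩ :=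
  Reach.congr (h := False) (t := a ∈ C) .refl Iff.rfl (by simp [ha])

theorem connects_of_colliderWalk (ha : a ∉ C) (hb : b ∉ C)
    (h : G.ColliderWalk (G.AntSet C a b) a b) : G.Connects C a b := by
  rcases (Reach.start ha).colliderWalk subset_rfl (.inr (.inl (.refl a))) h hb with h | ⟨_, h⟩
  · exact h
  · exact ⟨_, h⟩

/-- A walk in the graph of the collider walks can be turned into a connecting walk. -/
theorem connects_of_reflTransGen (ha : a ∉ C)
    (h : Relation.ReflTransGen (fun u v => u ∈ G.AntSet C a b ∧ v ∉ C ∧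
      G.ColliderWalk (G.AntSet C a b) u v) a b) : G.Connects C a b := by
  have key : ∀ w, Relation.ReflTransGen (fun u v => u ∈ G.AntSet C a b ∧ v ∉ C ∧
      G.ColliderWalk (G.AntSet C a b) u v) a w →
      G.Connects C a b ∨ ∃ h', G.Reach C a ⟨w, h', False⟩ := by
    intro w hw
    induction hw with
    | refl => exact .inr ⟨_, .start ha⟩
    | tail _ hvw ih =>
      rcases ih with h1 | ⟨h', h1⟩
      · exact .inl h1
      · exact h1.colliderWalk subset_rfl hvw.1 hvw.2.2 hvw.2.1
  exact (key b h).elim id id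

/-! ### Collider walks from connecting walks -/

/-- Traced backwards, a section entered through a tail leads along lines and outgoing arrows to `a`
or to a section hit by `C`; so `D`, being closed under anteriors, contains it. -/
theorem ant_of_reach_of_reach {D : Set V} {s : WalkState V} (hs : G.Reach C a s)
    (hD : ∀ u v, v ∈ D → G.Ant u v → u ∈ D) (haD : a ∈ D) (hCD : C ⊆ D) :
    (¬ s.head ∨ s.hit) → s.vert ∈ D := by
  induction hs with
  | refl => exact fun _ => haD
  | @tail s s' _ hst ih =>
    cases hst with
    | @line u v h t hl =>
      rintro (h1 | h1 | h1)
      · exact hD _ _ (ih (.inl h1)) (.of_line (G.line_symm _ _ hl))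
      · exact hD _ _ (ih (.inr h1)) (.of_line (G.line_symm _ _ hl))
      · exact hCD h1
    | @forward u v h t ha ht => exact fun h1 => hCD (by simpa using h1)
    | @backward u v h t ha ht =>
      intro _
      refine hD _ _ (ih ?_) (.of_arrow ha)
      change ¬ h ∨ t
      tauto
    | @arc u v h t ha ht => exact fun h1 => hCD (by simpa using h1)

/-- An exit through a line or a tail makes the vertex anterior to the next one, so membership
propagates back from `b`. Before an exit through an arrowhead the section is unentered by an
arrowhead or hit, and the previous lemma applies. -/
theorem mem_of_reach_of_coreach {D : Set V} {s : WalkState V} (hs : G.Reach C a s)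
    (hD : ∀ u v, v ∈ D → G.Ant u v → u ∈ D) (haD : a ∈ D) (hbD : b ∈ D) (hCD : C ⊆ D) {h : Prop}
    (hs' : Relation.ReflTransGen (G.Step C) s ⟨b, h, False⟩) : s.vert ∈ D := by
  induction hs' using Relation.ReflTransGen.head_induction_on with
  | refl => exact hbD
  | @head s s' hst _ ih =>
    have h1 := ih (hs.tail hst)
    have h2 := ant_of_reach_of_reach hs hD haD hCD
    cases hst with
    | line hl => exact hD _ _ h1 (.of_line hl)
    | forward ha ht => exact hD _ _ h1 (.of_arrow ha)
    | @backward u v h t ha ht => exact h2 (show ¬ h ∨ t by tauto)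
    | @arc u v h t ha ht => exact h2 (show ¬ h ∨ t by tauto)

/-- The common anteriors of `a` and `b`. -/
def AntPair (G : MixedGraph V) (a b : V) : Set V := {v | G.Ant v a ∨ G.Ant v b}

theorem antPair_subset_antSet (C : Set V) (a b : V) : G.AntPair a b ⊆ G.AntSet C a b :=
  fun _ h => .inr h

theorem antPair_down {u v : V} (hv : v ∈ G.AntPair a b) (h : G.Ant u v) : u ∈ G.AntPair a b :=
  hv.imp h.trans h.trans

theorem left_mem_antPair (a b : V) : a ∈ G.AntPair a b := .inl (.refl a)

theorem right_mem_antPair (a b : V) : b ∈ G.AntPair a b := .inr (.refl b)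

/-- Vertices that are connected given their other anteriors are joined by a collider walk among
the anteriors. -/
theorem Connects.colliderWalk (hab : a ≠ b) (h : G.Connects (G.AntPair a b \ {a, b}) a b) :
    G.ColliderWalk (G.AntPair a b) a b := by
  obtain ⟨h, hR⟩ := h
  set D := G.AntPair a b
  set C := D \ {a, b} with hCdef
  by_contra hcon
  have haC : a ∉ C := by simp [hCdef]
  have hbC : b ∉ C := by simp [hCdef]
  have hC : ∀ v ∈ D, v ≠ a → v ≠ b → v ∈ C := fun v h1 h2 h3 => ⟨h1, by simp [h2, h3]⟩
  have hedge : ∀ {e}, ¬ G.HasEdge e a b := fun he => hcon (.inl ⟨_, he⟩)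
  have hwalk : ∀ {v}, G.HeadTo D a v → ¬ G.Into b v := fun h1 h2 => hcon (.inr ⟨_, h1, h2⟩)
  -- The walk stays in `D`, so every vertex other than `a` and `b` hits `C`. The second alternative
  -- is a dead end: a hit section entered through no arrowhead can only be prolonged by lines. The
  -- final state, unhit at `b`, satisfies none of the three.
  have key : ∀ s, G.Reach C a s → Relation.ReflTransGen (G.Step C) s ⟨b, h, False⟩ →
      (s.vert = a ∧ ¬ s.head) ∨ (¬ s.head ∧ s.hit) ∨
        (s.head ∧ G.HeadTo D a s.vert ∧ (s.vert = b → s.hit)) := by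
    intro s hs
    induction hs with
    | refl => exact fun _ => .inl ⟨rfl, id⟩
    | @tail s s' hs hst ih =>
      intro hs'
      have hmem : s'.vert ∈ D := mem_of_reach_of_coreach (D := D) (hs.tail hst)
        (fun _ _ => antPair_down) (left_mem_antPair a b) (right_mem_antPair a b)
        Set.sdiff_subset hs'
      have hmem0 : s.vert ∈ D := mem_of_reach_of_coreach (D := D) hs
        (fun _ _ => antPair_down) (left_mem_antPair a b) (right_mem_antPair a b)
        Set.sdiff_subset (.head hst hs')
      have hhit := Reach.hit_of_mem hs
      have hhit' := Reach.hit_of_mem (hs.tail hst)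
      have ih := ih (.head hst hs')
      cases hst with
      | @line u v h t hl =>
        simp only at *
        rcases ih with ⟨rfl, h1⟩ | ⟨h1, h2⟩ | ⟨h1, h2, h3⟩
        · refine .inr (.inl ⟨h1, .inr (hC _ hmem ?_ ?_)⟩)
          · rintro rfl; exact G.line_irrefl _ hl
          · rintro rfl; exact hedge (e := .line) hl
        · exact .inr (.inl ⟨h1, .inl h2⟩)
        · refine .inr (.inr ⟨h1, h2.tail hmem (.inl hl), ?_⟩)
          rintro rfl
          by_cases hub : u = v
          · exact .inl (h3 hub)
          by_cases hua : u = a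
          · subst hua; exact absurd hl (hedge (e := .line))
          exact .inl (hhit (hC _ hmem0 hua hub))
      | @forward u v h t harr ht =>
        simp only at *
        have hu : u = a := by
          rcases ih with ⟨h0, h1⟩ | ⟨h1, h2⟩ | ⟨h1, h2, h3⟩
          · exact h0
          · exact absurd h2 ht
          · by_contra hua
            by_cases hub : u = b
            · exact ht (h3 hub)
            · exact ht (hhit (hC _ hmem0 hua hub))
        subst hu
        refine .inr (.inr ⟨trivial, .of_into (.inl harr) hmem, ?_⟩)
        rintro rfl
        exact absurd harr (hedge (e := .forward))
      | @backward u v h t harr ht =>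
        simp only at *
        by_cases hva : v = a
        · exact .inl ⟨hva, id⟩
        by_cases hvb : v = b
        · subst hvb
          exfalso
          rcases ih with ⟨rfl, h1⟩ | ⟨h1, h2⟩ | ⟨h1, h2, h3⟩
          · exact hedge (e := .backward) harr
          · exact h1 (ht.1 h2)
          · exact hwalk h2 (.inl harr)
        · exact .inr (.inl ⟨id, hC _ hmem hva hvb⟩)
      | @arc u v h t harc ht =>
        simp only at *
        rcases ih with ⟨rfl, h1⟩ | ⟨h1, h2⟩ | ⟨h1, h2, h3⟩
        · refine .inr (.inr ⟨trivial, .of_into (.inr harc) hmem, ?_⟩)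
          rintro rfl
          exact absurd harc (hedge (e := .arc))
        · exact absurd (ht.1 h2) h1
        · refine .inr (.inr ⟨trivial, h2.tail hmem (.inr harc), ?_⟩)
          rintro rfl
          exact absurd (.inr (G.arc_symm _ _ harc)) (hwalk h2)
  rcases key _ hR .refl with ⟨h1, -⟩ | ⟨-, h1⟩ | ⟨-, -, h1⟩
  · exact hab h1.symm
  · exact h1
  · exact h1 rfl

/-! ### Inseparable pairs and their common neighbours -/

/-- Two vertices are inseparable if no set that avoids them separates them. -/
def Inseparable (G : MixedGraph V) (a b : V) : Prop :=
  ∀ C : Set V, a ∉ C → b ∉ C → G.Connects C a b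

/-- One conditioning set suffices: the remaining anteriors of `a` and `b`. If it does not separate
them, there is a collider walk among the anteriors, and this can be made connecting given any `C`.
-/
theorem inseparable_iff (hab : a ≠ b) :
    G.Inseparable a b ↔ G.ColliderWalk (G.AntPair a b) a b :=
  ⟨fun h => (h _ (by simp) (by simp)).colliderWalk hab, fun h C ha hb =>
    connects_of_colliderWalk ha hb (h.mono (antPair_subset_antSet C a b))⟩

theorem Inseparable.of_connects (hab : a ≠ b) (h : G.Connects (G.AntPair a b \ {a, b}) a b) :
    G.Inseparable a b :=
  (inseparable_iff hab).2 (h.colliderWalk hab)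

/-- A common neighbour `c` of `a` and `b` that is anterior to one of them is in every separator
of `a` and `b`. -/
theorem connects_of_mem_antPair {c : V} (hac : a ≠ c) (hcb : c ≠ b) (h1 : G.Inseparable a c)
    (h2 : G.Inseparable c b) (hc : c ∈ G.AntPair a b) (ha : a ∉ C) (hb : b ∉ C) (hcC : c ∉ C) :
    G.Connects C a b := by
  have hsub1 : G.AntPair a c ⊆ G.AntSet C a b :=
    (show G.AntPair a c ⊆ G.AntPair a b from
      fun v hv => hv.elim .inl fun h => antPair_down hc h).trans (antPair_subset_antSet C a b)
  have hsub2 : G.AntPair c b ⊆ G.AntSet C a b :=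
    (show G.AntPair c b ⊆ G.AntPair a b from
      fun v hv => hv.elim (fun h => antPair_down hc h) .inr).trans (antPair_subset_antSet C a b)
  refine connects_of_reflTransGen ha (.tail (.single ⟨?_, hcC, ?_⟩) ⟨?_, hb, ?_⟩)
  · exact hsub1 (left_mem_antPair a c)
  · exact ((inseparable_iff hac).1 h1).mono hsub1
  · exact hsub1 (right_mem_antPair a c)
  · exact ((inseparable_iff hcb).1 h2).mono hsub2

/-- The walk must arrive at `c` through an arrowhead. If it ended with an arrow `c → v`, then `v`
would be anterior to `a`, and so would `c`, or anterior to `c`, which closes a semi-directed cycle.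
-/
theorem ColliderWalk.headTo (hG : G.IsChainMixed) {c : V} (h : G.ColliderWalk (G.AntPair a c) a c)
    (hc : ¬ G.Ant c a) : G.HeadTo (G.AntPair a c) a c := by
  rcases h with ⟨e, he⟩ | ⟨v, hv, hcv⟩
  · cases e with
    | line => exact absurd (.of_line (G.line_symm _ _ he)) hc
    | forward => exact .of_into (.inl he) (right_mem_antPair a c)
    | backward => exact absurd (.of_arrow he) hc
    | arc => exact .of_into (.inr he) (right_mem_antPair a c)
  · rcases hcv with hcv | hcv
    · rcases hv.mem with h | h
      · exact absurd ((Ant.of_arrow hcv).trans h) hc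
      · exact absurd h (hG _ _ hcv)
    · exact hv.tail (right_mem_antPair a c) (.inr (G.arc_symm _ _ hcv))

/-- A common neighbour `c` of `a` and `b` that is anterior to neither of them is in no separator
of `a` and `b`. -/
theorem connects_of_notMem_antPair (hG : G.IsChainMixed) {c : V} (hac : a ≠ c) (hcb : c ≠ b)
    (h1 : G.Inseparable a c) (h2 : G.Inseparable c b) (hc : c ∉ G.AntPair a b) (ha : a ∉ C)
    (hb : b ∉ C) (hcC : c ∈ C) : G.Connects C a b := by
  have hca : ¬ G.Ant c a := fun h => hc (.inl h)
  have hcb' : ¬ G.Ant c b := fun h => hc (.inr h)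
  have e1 := ((inseparable_iff hac).1 h1).headTo hG hca
  have e2 := ((inseparable_iff hcb).1 h2).symm
  have hcomm : G.AntPair c b = G.AntPair b c := by
    ext v; exact or_comm
  rw [hcomm] at e2
  have e2 := e2.headTo hG hcb'
  have hcS : ∀ v, G.Ant v c → v ∈ G.AntSet C a b := fun v hv => .inl ⟨c, hcC, hv⟩
  have e1 := e1.mono (D' := G.AntSet C a b) fun v hv => hv.elim (fun h => .inr (.inl h)) (hcS v)
  have e2 := e2.mono (D' := G.AntSet C a b) fun v hv => hv.elim (fun h => .inr (.inr h)) (hcS v)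
  obtain ⟨u, hu, hau, huc⟩ := e1
  obtain ⟨v, hv, hbv, hvc⟩ := e2
  -- Both walks reach `c` through arrowheads; glued there, they form one collider walk inside
  -- `AntSet`, because `c ∈ C`.
  exact connects_of_colliderWalk ha hb (.inr ⟨v, ⟨u, hu, hau, huc.trans hvc.symm⟩, hbv⟩)

end MixedGraph

/-! ### Markov equivalence to undirected and bidirected graphs -/

namespace MixedGraph

variable {V : Type*} {G H : MixedGraph V} {C : Set V} {a b : V} {S : SimpleGraph V}

theorem separated_singleton : G.Separated {a} {b} C ↔ ¬ G.Connects C a b := by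
  simp [separated_iff]

theorem markovEquiv_iff : G.MarkovEquiv H ↔ ∀ (a b : V) (C : Set V), a ≠ b → a ∉ C → b ∉ C →
    (G.Connects C a b ↔ H.Connects C a b) := by
  constructor
  · intro h a b C hab ha hb
    have := h {a} {b} C (by simpa using hab) (by simpa using ha) (by simpa using hb)
    rwa [separated_singleton, separated_singleton, not_iff_not] at this
  · intro h A B C hAB hAC hBC
    rw [separated_iff, separated_iff]
    refine forall₂_congr fun a ha => forall₂_congr fun b hb => not_congr ?_
    exact h a b C (fun e => Set.disjoint_left.1 hAB ha (e ▸ hb)) (Set.disjoint_left.1 hAC ha)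
      (Set.disjoint_left.1 hBC hb)

theorem MarkovEquiv.inseparable_iff (h : G.MarkovEquiv H) (hab : a ≠ b) :
    G.Inseparable a b ↔ H.Inseparable a b :=
  forall_congr' fun C => forall₂_congr fun ha hb => markovEquiv_iff.1 h a b C hab ha hb

theorem inseparable_of_edgeAdj (hab : a ≠ b) (h : G.EdgeAdj a b) : G.Inseparable a b :=
  (MixedGraph.inseparable_iff hab).2 (.inl h)

/-- There is a walk from `a` to `b` in `S` that avoids `C`. -/
def Joined (S : SimpleGraph V) (C : Set V) (a b : V) : Prop :=
  Relation.ReflTransGen (fun u v => S.Adj u v ∧ v ∉ C) a b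

theorem connects_undirected_iff (ha : a ∉ C) :
    (undirected S).Connects C a b ↔ Joined S C a b := by
  constructor
  · rintro ⟨h, hr⟩
    suffices ∀ s, (undirected S).Reach C a s → ¬ s.hit → Joined S C a s.vert from
      this _ hr id
    intro s hs
    induction hs with
    | refl => exact fun _ => .refl
    | tail _ hst ih =>
      cases hst with
      | line hl => exact fun h => .tail (ih fun h' => h (.inl h')) ⟨hl, fun h' => h (.inr h')⟩
      | forward h _ => exact h.elim
      | backward h _ => exact h.elim
      | arc h _ => exact h.elim
  · intro h
    refine ⟨False, ?_⟩
    induction h with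
    | refl => exact Reach.start ha
    | @tail u v _ h ih =>
      exact Reach.congr (ih.tail (.line (G := undirected S) h.1)) Iff.rfl (by simp [h.2])

/-- Given `{u, v}ᶜ`, every vertex is in `AntSet`, so any collider walk between `u` and `v` connects
them and forces adjacency in `S`. Replacing each collider stretch of a connecting walk by such an
edge leaves a walk in `S` outside `C`. -/
theorem joined_of_connects (hP : ∀ a b, a ≠ b → ¬ S.Adj a b → ¬ G.Connects {a, b}ᶜ a b)
    (h : G.Connects C a b) : Joined S C a b := by
  have hcw : ∀ u v, u ≠ v → G.ColliderWalk Set.univ u v → S.Adj u v := by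
    intro u v huv hw
    by_contra hcon
    refine hP u v huv hcon (connects_of_colliderWalk (by simp) (by simp) (hw.mono ?_))
    intro w _
    by_cases h : w ∈ ({u, v} : Set V)ᶜ
    · exact .inl ⟨w, h, .refl w⟩
    · have h' : w = u ∨ w = v := by simpa [or_iff_not_imp_left] using h
      rcases h' with rfl | rfl
      · exact .inr (.inl (.refl w))
      · exact .inr (.inr (.refl w))
  have hjoin : ∀ {u v}, Joined S C a u → G.ColliderWalk Set.univ u v → v ∉ C →
      Joined S C a v := by
    intro u v hu huv hv
    by_cases h : u = v
    · exact h ▸ hu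
    · exact hu.tail ⟨hcw u v h huv, hv⟩
  obtain ⟨h, hr⟩ := h
  -- In a section entered through an arrowhead, `p` is the vertex from which the current collider
  -- stretch set out.
  suffices key : ∀ s, G.Reach C a s → (¬ s.hit → Joined S C a s.vert) ∧
      (s.head → ∃ p, Joined S C a p ∧ G.HeadTo Set.univ p s.vert) from (key _ hr).1 id
  intro s hs
  induction hs with
  | refl => exact ⟨fun _ => .refl, False.elim⟩
  | tail _ hst ih =>
    obtain ⟨ih1, ih2⟩ := ih
    cases hst with
    | @line u v h t hl =>
      refine ⟨fun hn => hjoin (ih1 fun h' => hn (.inl h')) (.inl ⟨.line, hl⟩)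
        (fun h' => hn (.inr h')), fun hh => ?_⟩
      obtain ⟨p, h1, h2⟩ := ih2 hh
      exact ⟨p, h1, h2.tail trivial (.inl hl)⟩
    | @forward u v h t harr ht =>
      exact ⟨fun hn => hjoin (ih1 ht) (.inl ⟨.forward, harr⟩) hn,
        fun _ => ⟨u, ih1 ht, .of_into (.inl harr) trivial⟩⟩
    | @backward u v h t harr ht =>
      refine ⟨fun hn => ?_, False.elim⟩
      by_cases hh : h
      · obtain ⟨p, h1, h2⟩ := ih2 hh
        exact hjoin h1 (.inr ⟨u, h2, .inl harr⟩) hn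
      · exact hjoin (ih1 fun h' => hh (ht.1 h')) (.inl ⟨.backward, harr⟩) hn
    | @arc u v h t harc ht =>
      by_cases hh : h
      · obtain ⟨p, h1, h2⟩ := ih2 hh
        exact ⟨fun hn => hjoin h1 (.inr ⟨u, h2, .inr (G.arc_symm _ _ harc)⟩) hn,
          fun _ => ⟨p, h1, h2.tail trivial (.inr harc)⟩⟩
      · have h1 := ih1 fun h' => hh (ht.1 h')
        exact ⟨fun hn => hjoin h1 (.inl ⟨.arc, harc⟩) hn,
          fun _ => ⟨u, h1, .of_into (.inr harc) trivial⟩⟩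

/-- A permutation of the vertices that preserves the separations between vertices. -/
def Preserves (G : MixedGraph V) (σ : Equiv.Perm V) : Prop :=
  ∀ (a b : V) (C : Set V), a ≠ b → a ∉ C → b ∉ C →
    (G.Connects C a b ↔ G.Connects (σ '' C) (σ a) (σ b))

theorem Preserves.inseparable_iff {σ : Equiv.Perm V} (hσ : G.Preserves σ) (hab : a ≠ b) :
    G.Inseparable a b ↔ G.Inseparable (σ a) (σ b) := by
  constructor
  · intro h C ha hb
    have := (hσ a b (σ ⁻¹' C) hab ha hb).1 (h _ ha hb)
    rwa [Set.image_preimage_eq _ σ.surjective] at this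
  · intro h C ha hb
    exact (hσ a b C hab ha hb).2 (h _ (by simpa using ha) (by simpa using hb))

/-- As all vertices are anterior to `x` or `y`, the set `{x, y}ᶜ` separates them, and their `AntSet`
is everything for any `C`, so each edge of `S` can be traversed as a collider walk. `htrans`
transports both facts to the other nonadjacent pairs. -/
theorem markovEquiv_undirected {x y : V} (hS : ∀ a b, a ≠ b → (S.Adj a b ↔ G.Inseparable a b))
    (hxy : x ≠ y) (hadj : ¬ S.Adj x y) (hall : ∀ v, v ∈ G.AntPair x y)
    (htrans : ∀ a b, a ≠ b → ¬ S.Adj a b → ∃ σ, G.Preserves σ ∧ σ a = x ∧ σ b = y) :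
    G.MarkovEquiv (undirected S) := by
  refine markovEquiv_iff.2 fun a b C hab ha hb => ?_
  rw [connects_undirected_iff ha]
  have hxy' : ¬ G.Connects {x, y}ᶜ x y := by
    intro h
    refine hadj ((hS x y hxy).2 (.of_connects hxy ?_))
    rwa [Set.eq_univ_of_forall hall, ← Set.compl_eq_univ_sdiff]
  refine ⟨joined_of_connects fun u v huv hnadj h => hxy' ?_, fun h => ?_⟩
  · obtain ⟨σ, hσ, rfl, rfl⟩ := htrans u v huv hnadj
    have := (hσ u v _ huv (by simp) (by simp)).1 h
    rwa [Set.image_compl_eq σ.bijective, Set.image_pair] at this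
  · by_cases hadj' : S.Adj a b
    · exact (hS a b hab).1 hadj' C ha hb
    obtain ⟨σ, hσ, rfl, rfl⟩ := htrans a b hab hadj'
    rw [hσ a b C hab ha hb]
    have huniv : ∀ v, v ∈ G.AntSet (σ '' C) (σ a) (σ b) := fun v => .inr (hall v)
    refine connects_of_reflTransGen (by simpa using ha) (Relation.ReflTransGen.lift σ ?_ _ _ h)
    rintro u v ⟨huv, hv⟩
    refine ⟨huniv _, by simpa using hv, ?_⟩
    exact ((MixedGraph.inseparable_iff (σ.injective.ne huv.ne)).1
      ((hσ.inseparable_iff huv.ne).1 ((hS u v huv.ne).1 huv))).mono fun v _ => huniv v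

theorem ext {G H : MixedGraph V} (h1 : G.line = H.line) (h2 : G.arrow = H.arrow)
    (h3 : G.arc = H.arc) : G = H := by
  cases G; cases H; cases h1; cases h2; cases h3; rfl

/-- A line or an arrow would make a vertex anterior to a neighbour. Without them each vertex is its
own only anterior, and a collider walk inside `{u, v}` contains an arc between `u` and `v`. -/
theorem eq_bidirected (hS : ∀ a b, a ≠ b → (S.Adj a b ↔ G.Inseparable a b))
    (hant : ∀ a b, S.Adj a b → ¬ G.Ant a b) : G = bidirected S := by
  have hne : ∀ {e u v}, G.HasEdge e u v → S.Adj u v := by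
    intro e u v he
    have huv : u ≠ v := by
      rintro rfl
      cases e with
      | line => exact G.line_irrefl _ he
      | forward => exact G.arrow_irrefl _ he
      | backward => exact G.arrow_irrefl _ he
      | arc => exact G.arc_irrefl _ he
    exact (hS u v huv).2 (inseparable_of_edgeAdj huv ⟨e, he⟩)
  have hline : ∀ u v, ¬ G.line u v := fun u v h => hant u v (hne (e := .line) h) (.of_line h)
  have harrow : ∀ u v, ¬ G.arrow u v := fun u v h =>
    hant u v (hne (e := .forward) h) (.of_arrow h)
  have hant' : ∀ u v, G.Ant u v → u = v := by
    intro u v h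
    rcases Relation.ReflTransGen.cases_head h with h | ⟨w, h | h, -⟩
    · exact h
    · exact absurd h (hline _ _)
    · exact absurd h (harrow _ _)
  refine ext (by ext u v; exact iff_of_false (hline u v) id)
    (by ext u v; exact iff_of_false (harrow u v) id) ?_
  ext u v
  refine ⟨fun h => hne (e := .arc) h, fun h => ?_⟩
  have huv : u ≠ v := h.ne
  rcases (MixedGraph.inseparable_iff huv).1 ((hS u v huv).1 h) with
    ⟨e, he⟩ | ⟨w, ⟨x, hx, hux, hxw⟩, hvw⟩
  · cases e with
    | line => exact absurd he (hline _ _)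
    | forward => exact absurd he (harrow _ _)
    | backward => exact absurd he (harrow _ _)
    | arc => exact he
  · have hw : w ∈ G.AntPair u v := hxw.mem hx
    rcases hux with hux | hux
    · exact absurd hux (harrow _ _)
    rcases hvw with hvw | hvw
    · exact absurd hvw (harrow _ _)
    rcases hx.imp (hant' _ _) (hant' _ _) with rfl | rfl
    · exact absurd hux (G.arc_irrefl _)
    · exact hux

theorem MarkovEquiv.refl (G : MixedGraph V) : G.MarkovEquiv G := fun _ _ _ _ _ _ => Iff.rfl

theorem markovEquiv_of_forall_inseparable (h : ∀ a b, a ≠ b → (G.Inseparable a b))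
    (h' : ∀ a b, a ≠ b → (H.Inseparable a b)) : G.MarkovEquiv H :=
  markovEquiv_iff.2 fun a b C hab ha hb => iff_of_true (h a b hab C ha hb) (h' a b hab C ha hb)

theorem markovEquiv_empty (h : ∀ a b, a ≠ b → ¬ G.Inseparable a b) :
    G.MarkovEquiv (undirected ⊥) := by
  have hne : ∀ e u v, ¬ G.HasEdge e u v := by
    intro e u v he
    by_cases huv : u = v
    · subst huv
      cases e with
      | line => exact G.line_irrefl _ he
      | forward => exact G.arrow_irrefl _ he
      | backward => exact G.arrow_irrefl _ he
      | arc => exact G.arc_irrefl _ he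
    · exact h u v huv (inseparable_of_edgeAdj huv ⟨e, he⟩)
  have : G = undirected ⊥ := ext (by ext u v; exact iff_of_false (hne .line u v) id)
    (by ext u v; exact iff_of_false (hne .forward u v) id)
    (by ext u v; exact iff_of_false (hne .arc u v) id)
  rw [this]
  exact .refl _

end MixedGraph

/-! ### Graphs whose unshielded triples are all alike -/

namespace MixedGraph

variable {V : Type*} {G : MixedGraph V} {C : Set V} {a b c : V} {S : SimpleGraph V}

/-- `a` and `b` are not adjacent in `S`, and `c` is a common neighbour of them. -/
structure Unshielded (S : SimpleGraph V) (a c b : V) : Prop where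
  left : S.Adj a c
  right : S.Adj c b
  ne : a ≠ b
  nadj : ¬ S.Adj a b

/-- The neighbours of an element of `D` that are not in `D` form a clique. -/
def OutsideClique (S : SimpleGraph V) (D : Set V) : Prop :=
  ∀ a c b, c ∈ D → Unshielded S a c b → a ∈ D ∨ b ∈ D

/-- The properties of the incidence graph and of its complement that are used. -/
structure Rigid (S : SimpleGraph V) : Prop where
  exists_middle : ∀ a b, a ≠ b → ¬ S.Adj a b → ∃ c, Unshielded S a c b
  exists_end : ∀ a c, S.Adj a c → ∃ b, Unshielded S a c b
  exists_nonadj : ∀ a, ∃ b, a ≠ b ∧ ¬ S.Adj a b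
  outsideClique : ∀ D E : Set V, OutsideClique S D → OutsideClique S E → D.Nonempty →
    E.Nonempty → Disjoint D E →
    (∀ v, v ∈ D ∨ v ∈ E) ∧ ∃ x ∈ D, ∃ y ∈ E, ¬ S.Adj x y

/-- Preorder the vertices by `Ant`. By `hant` each principal up-set satisfies `OutsideClique`. If
everything lies below one maximal `t`, a non-neighbour of `t` completes the pair. Otherwise two
maximal classes are disjoint, and rigidity makes them cover `V` and supplies nonadjacent members. -/
theorem exists_antPair_eq_univ [Finite V] (hR : Rigid S)
    (hant : ∀ a c b, Unshielded S a c b → c ∈ G.AntPair a b) (v₀ : V) :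
    ∃ x y, x ≠ y ∧ ¬ S.Adj x y ∧ ∀ v, v ∈ G.AntPair x y := by
  let _ : Preorder V :=
    { le := G.Ant
      le_refl := Ant.refl
      le_trans := fun _ _ _ => Ant.trans }
  have htop : ∀ v, ∃ t, G.Ant v t ∧ ∀ w, G.Ant t w → G.Ant w t := by
    intro v
    obtain ⟨t, h1, h2⟩ := Finite.exists_le_maximal (p := fun _ : V => True) (a := v) trivial
    exact ⟨t, h1, fun w hw => h2.2 trivial hw⟩
  have hD : ∀ t, OutsideClique S {v | G.Ant t v} := fun t a c b hc hacb =>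
    (hant a c b hacb).imp (fun h => Ant.trans hc h) (fun h => Ant.trans hc h)
  obtain ⟨t, -, ht⟩ := htop v₀
  by_cases hall : ∀ v, G.Ant v t
  · obtain ⟨y, h1, h2⟩ := hR.exists_nonadj t
    exact ⟨t, y, h1, h2, fun v => .inl (hall v)⟩
  push Not at hall
  obtain ⟨v₁, hv₁⟩ := hall
  obtain ⟨t', ht', ht'top⟩ := htop v₁
  have hdisj : Disjoint {v | G.Ant t v} {v | G.Ant t' v} := Set.disjoint_left.2 fun v h1 h2 =>
    hv₁ (ht'.trans (Ant.trans h2 (ht v h1)))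
  obtain ⟨hcov, x, hx, y, hy, hxy⟩ := hR.outsideClique _ _ (hD t) (hD t') ⟨t, .refl t⟩
    ⟨t', .refl t'⟩ hdisj
  refine ⟨x, y, fun e => Set.disjoint_left.1 hdisj hx (e ▸ hy), hxy, fun v => ?_⟩
  exact (hcov v).imp (fun h => (ht v h).trans hx) (fun h => (ht'top v h).trans hy)

/-- Together with the next lemma: all separators of `a` and `b` agree on whether they contain `c`.
-/
theorem mem_antPair_of_mem_separator (hG : G.IsChainMixed)
    (hS : ∀ a b, a ≠ b → (S.Adj a b ↔ G.Inseparable a b)) (h : Unshielded S a c b) (ha : a ∉ C)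
    (hb : b ∉ C) (hC : ¬ G.Connects C a b) (hc : c ∈ C) : c ∈ G.AntPair a b := by
  by_contra hcon
  exact hC (connects_of_notMem_antPair hG h.left.ne h.right.ne
    ((hS _ _ h.left.ne).1 h.left) ((hS _ _ h.right.ne).1 h.right) hcon ha hb hc)

theorem notMem_antPair_of_notMem_separator
    (hS : ∀ a b, a ≠ b → (S.Adj a b ↔ G.Inseparable a b)) (h : Unshielded S a c b) (ha : a ∉ C)
    (hb : b ∉ C) (hC : ¬ G.Connects C a b) (hc : c ∉ C) : c ∉ G.AntPair a b := fun hcon =>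
  hC (connects_of_mem_antPair h.left.ne h.right.ne
    ((hS _ _ h.left.ne).1 h.left) ((hS _ _ h.right.ne).1 h.right) hcon ha hb hc)

/-- The unshielded triples of the inseparability graph `S` of `G` are all alike. -/
def TripleTransitive (G : MixedGraph V) (S : SimpleGraph V) : Prop :=
  ∀ a c b a' c' b', Unshielded S a c b → Unshielded S a' c' b' →
    ∃ σ, G.Preserves σ ∧ σ a = a' ∧ σ c = c' ∧ σ b = b'

theorem markovEquiv_undirected_of_mem_separator [Finite V] (hG : G.IsChainMixed) (hR : Rigid S)
    (hS : ∀ a b, a ≠ b → (S.Adj a b ↔ G.Inseparable a b)) (hT : G.TripleTransitive S)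
    (h : Unshielded S a c b) (ha : a ∉ C) (hb : b ∉ C) (hC : ¬ G.Connects C a b) (hc : c ∈ C) :
    G.MarkovEquiv (undirected S) := by
  have hant : ∀ a' c' b', Unshielded S a' c' b' → c' ∈ G.AntPair a' b' := by
    intro a' c' b' h'
    obtain ⟨σ, hσ, rfl, rfl, rfl⟩ := hT _ _ _ _ _ _ h h'
    exact mem_antPair_of_mem_separator (C := σ '' C) hG hS h' (by simpa using ha)
      (by simpa using hb) (fun h'' => hC ((hσ a b C h.ne ha hb).2 h'')) (by simpa using hc)
  obtain ⟨x, y, hxy, hadj, hall⟩ := exists_antPair_eq_univ hR hant a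
  refine markovEquiv_undirected hS hxy hadj hall fun u v huv hnadj => ?_
  obtain ⟨w, hw⟩ := hR.exists_middle u v huv hnadj
  obtain ⟨z, hz⟩ := hR.exists_middle x y hxy hadj
  obtain ⟨σ, hσ, h1, -, h2⟩ := hT _ _ _ _ _ _ hw hz
  exact ⟨σ, hσ, h1, h2⟩

theorem markovEquiv_bidirected_of_notMem_separator (hR : Rigid S)
    (hS : ∀ a b, a ≠ b → (S.Adj a b ↔ G.Inseparable a b)) (hT : G.TripleTransitive S)
    (h : Unshielded S a c b) (ha : a ∉ C) (hb : b ∉ C) (hC : ¬ G.Connects C a b) (hc : c ∉ C) :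
    G.MarkovEquiv (bidirected S) := by
  have hant : ∀ a' c' b', Unshielded S a' c' b' → c' ∉ G.AntPair a' b' := by
    intro a' c' b' h'
    obtain ⟨σ, hσ, rfl, rfl, rfl⟩ := hT _ _ _ _ _ _ h h'
    exact notMem_antPair_of_notMem_separator (C := σ '' C) hS h' (by simpa using ha)
      (by simpa using hb) (fun h'' => hC ((hσ a b C h.ne ha hb).2 h'')) (by simpa using hc)
  rw [eq_bidirected hS fun u v huv huv' => ?_]
  · exact .refl _
  -- If `u` were anterior to its neighbour `v`, it would be a forbidden middle of an unshielded
  -- triple `v, u, w`.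
  · obtain ⟨w, hw⟩ := hR.exists_end v u huv.symm
    exact hant _ _ _ hw (.inl huv')

end MixedGraph

/-! ### The incidence graph and its complement -/

section Dyads

open MixedGraph

variable {N : Type*}

theorem Dyad.exists_eq (d : Dyad N) : ∃ i j h, d = dyad i j h := by
  obtain ⟨d, hd⟩ := d
  induction d with
  | h i j => exact ⟨i, j, by simpa using hd, rfl⟩

theorem dyad_comm {i j : N} (h : i ≠ j) : dyad i j h = dyad j i h.symm :=
  Subtype.ext Sym2.eq_swap

theorem dyad_inj {i j k l : N} {h : i ≠ j} {h' : k ≠ l} :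
    dyad i j h = dyad k l h' ↔ (i = k ∧ j = l) ∨ (i = l ∧ j = k) :=
  Subtype.ext_iff.trans Sym2.eq_iff

theorem incidenceGraph_adj {i j k l : N} {h : i ≠ j} {h' : k ≠ l} :
    (incidenceGraph N).Adj (dyad i j h) (dyad k l h') ↔
      ¬ ((i = k ∧ j = l) ∨ (i = l ∧ j = k)) ∧ (i = k ∨ i = l ∨ j = k ∨ j = l) := by
  rw [incidenceGraph, SimpleGraph.lineGraph_adj_iff_exists, ne_eq, dyad_inj]
  refine and_congr_right fun _ => ?_
  simp only [dyad, Sym2.mem_iff]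
  constructor
  · rintro ⟨v, rfl | rfl, rfl | rfl⟩ <;> simp
  · rintro (h | h | h | h)
    exacts [⟨i, by simp, by simp [h]⟩, ⟨i, by simp, by simp [h]⟩, ⟨j, by simp, by simp [h]⟩,
      ⟨j, by simp, by simp [h]⟩]

theorem compl_incidenceGraph_adj {i j k l : N} {h : i ≠ j} {h' : k ≠ l} :
    (incidenceGraph N)ᶜ.Adj (dyad i j h) (dyad k l h') ↔ i ≠ k ∧ i ≠ l ∧ j ≠ k ∧ j ≠ l := by
  rw [SimpleGraph.compl_adj, incidenceGraph_adj, ne_eq, dyad_inj]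
  grind

theorem unshielded_incidenceGraph_iff {a c b : Dyad N} :
    Unshielded (incidenceGraph N) a c b ↔ ∃ i j k l, ∃ (hij : i ≠ j) (hik : i ≠ k) (hkl : k ≠ l),
      i ≠ l ∧ j ≠ k ∧ j ≠ l ∧ a = dyad i j hij ∧ c = dyad i k hik ∧ b = dyad k l hkl := by
  constructor
  · rintro ⟨h1, h2, h3, h4⟩
    obtain ⟨p, q, hpq, rfl⟩ := a.exists_eq
    obtain ⟨r, s, hrs, rfl⟩ := c.exists_eq
    obtain ⟨t, u, htu, rfl⟩ := b.exists_eq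
    rw [incidenceGraph_adj] at h1 h2 h4
    rw [ne_eq, dyad_inj] at h3
    have hd : p ≠ t ∧ p ≠ u ∧ q ≠ t ∧ q ≠ u := by grind
    simp only [dyad_inj]
    rcases h1.2 with h | h | h | h
    · rcases (show s = t ∨ s = u by grind) with h' | h'
      · exact ⟨p, q, s, u, by grind⟩
      · exact ⟨p, q, s, t, by grind⟩
    · rcases (show r = t ∨ r = u by grind) with h' | h'
      · exact ⟨p, q, r, u, by grind⟩
      · exact ⟨p, q, r, t, by grind⟩
    · rcases (show s = t ∨ s = u by grind) with h' | h'
      · exact ⟨q, p, s, u, by grind⟩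
      · exact ⟨q, p, s, t, by grind⟩
    · rcases (show r = t ∨ r = u by grind) with h' | h'
      · exact ⟨q, p, r, u, by grind⟩
      · exact ⟨q, p, r, t, by grind⟩
  · rintro ⟨i, j, k, l, hij, hik, hkl, hil, hjk, hjl, rfl, rfl, rfl⟩
    refine ⟨?_, ?_, ?_, ?_⟩ <;> simp only [incidenceGraph_adj, ne_eq, dyad_inj] <;> grind

theorem unshielded_compl_incidenceGraph_iff {a c b : Dyad N} :
    Unshielded (incidenceGraph N)ᶜ a c b ↔
      ∃ i j k l m, ∃ (hij : i ≠ j) (hik : i ≠ k) (hlm : l ≠ m),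
        j ≠ k ∧ i ≠ l ∧ i ≠ m ∧ j ≠ l ∧ j ≠ m ∧ k ≠ l ∧ k ≠ m ∧
        a = dyad i j hij ∧ b = dyad i k hik ∧ c = dyad l m hlm := by
  constructor
  · rintro ⟨h1, h2, h3, h4⟩
    obtain ⟨p, q, hpq, rfl⟩ := a.exists_eq
    obtain ⟨r, s, hrs, rfl⟩ := c.exists_eq
    obtain ⟨t, u, htu, rfl⟩ := b.exists_eq
    rw [compl_incidenceGraph_adj] at h1 h2 h4
    rw [ne_eq, dyad_inj] at h3
    have hd : p = t ∨ p = u ∨ q = t ∨ q = u := by grind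
    simp only [dyad_inj]
    rcases hd with rfl | rfl | rfl | rfl
    · exact ⟨p, q, u, r, s, by grind⟩
    · exact ⟨p, q, t, r, s, by grind⟩
    · exact ⟨q, p, u, r, s, by grind⟩
    · exact ⟨q, p, t, r, s, by grind⟩
  · rintro ⟨i, j, k, l, m, hij, hik, hlm, hjk, hil, him, hjl, hjm, hkl, hkm, rfl, rfl, rfl⟩
    refine ⟨?_, ?_, ?_, ?_⟩ <;> simp only [compl_incidenceGraph_adj, ne_eq, dyad_inj] <;> grind

/-! ### Rigidity of the two dyad graphs -/

/-- The dyad with the endpoints `i` and `j` is in `D`. -/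
def HasDyad (D : Set (Dyad N)) (i j : N) : Prop := ∃ h : i ≠ j, dyad i j h ∈ D

theorem HasDyad.symm {D : Set (Dyad N)} {i j : N} (h : HasDyad D i j) : HasDyad D j i := by
  obtain ⟨h, hD⟩ := h
  exact ⟨h.symm, dyad_comm h ▸ hD⟩

theorem HasDyad.disjoint {D E : Set (Dyad N)} (hDE : Disjoint D E) {i j : N} (h : HasDyad D i j)
    (h' : HasDyad E i j) : False :=
  Set.disjoint_left.1 hDE h.2 h'.2

theorem exists_fresh {s : Finset N} (hN : s.card < Nat.card N) : ∃ x, x ∉ s := by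
  by_contra! h
  have : (s : Set N) = Set.univ := Set.eq_univ_of_forall h
  have := Set.ncard_coe_finset s ▸ this ▸ Set.ncard_univ N
  omega

theorem MixedGraph.OutsideClique.incidence {D : Set (Dyad N)}
    (hD : OutsideClique (incidenceGraph N) D)
    {i j k l : N} (h : HasDyad D i j) (hik : i ≠ k) (hjk : j ≠ k) (hil : i ≠ l) (hjl : j ≠ l)
    (hkl : k ≠ l) : HasDyad D i k ∨ HasDyad D j l :=
  (hD (dyad i k hik) _ (dyad j l hjl) h.2 (unshielded_incidenceGraph_iff.2
    ⟨i, k, j, l, hik, h.1, hjl, hil, hjk.symm, hkl, rfl, rfl, rfl⟩)).imp (⟨hik, ·⟩) (⟨hjl, ·⟩)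

theorem MixedGraph.OutsideClique.compl {D : Set (Dyad N)} (hD : OutsideClique (incidenceGraph N)ᶜ D)
    {i j k l m : N} (h : HasDyad D i j) (hik : i ≠ k) (hjk : j ≠ k) (hil : i ≠ l) (hjl : j ≠ l)
    (him : i ≠ m) (hjm : j ≠ m) (hkl : k ≠ l) (hkm : k ≠ m) (hlm : l ≠ m) :
    HasDyad D k l ∨ HasDyad D k m :=
  (hD (dyad k l hkl) _ (dyad k m hkm) h.2 (unshielded_compl_incidenceGraph_iff.2
    ⟨k, l, m, i, j, hkl, hkm, h.1, hlm, hik.symm, hjk.symm, hil.symm, hjl.symm, him.symm, hjm.symm,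
      rfl, rfl, rfl⟩)).imp (⟨hkl, ·⟩) (⟨hkm, ·⟩)

theorem outsideClique_incidence_aux (hN : 5 ≤ Nat.card N) {D E : Set (Dyad N)}
    (hD : OutsideClique (incidenceGraph N) D) (hE : OutsideClique (incidenceGraph N) E)
    (hDE : Disjoint D E) {i j k : N} (hjk : j ≠ k) (h1 : HasDyad D i j) (h2 : HasDyad E i k) :
    (∀ v, v ∈ D ∨ v ∈ E) ∧ ∃ x ∈ D, ∃ y ∈ E, ¬ (incidenceGraph N).Adj x y := by
  classical
  have hdis : ∀ {p q}, HasDyad D p q → HasDyad E p q → False := HasDyad.disjoint hDE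
  have hij := h1.1
  have hik := h2.1
  -- The triple `ik, ij, jl` has its middle in `D` and `ik` in `E`, which forces `jl` into `D`. The
  -- mirrored triple forces `kl` into `E`.
  have hjl : ∀ l, l ≠ i → l ≠ j → l ≠ k → HasDyad D j l := fun l a b c =>
    (hD.incidence h1 hik hjk a.symm b.symm c.symm).resolve_left fun h => hdis h h2
  have hkl : ∀ l, l ≠ i → l ≠ j → l ≠ k → HasDyad E k l := fun l a b c =>
    (hE.incidence h2 hij hjk.symm a.symm c.symm b.symm).resolve_left fun h => hdis h1 h
  have hd : ∀ l m, l ≠ i → l ≠ j → l ≠ k → m ≠ l → m ≠ j → m ≠ k →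
      HasDyad D l m ∨ HasDyad D j k := fun l m a b c d e f =>
    hD.incidence (hjl l a b c).symm d.symm e.symm c hjk f
  have he : ∀ l m, l ≠ i → l ≠ j → l ≠ k → m ≠ l → m ≠ j → m ≠ k →
      HasDyad E l m ∨ HasDyad E j k := fun l m a b c d e f =>
    (hE.incidence (hkl l a b c).symm d.symm f.symm b hjk.symm e).imp_right HasDyad.symm
  have hpair : ∀ l m, l ≠ i → l ≠ j → l ≠ k → m ≠ l → m ≠ j → m ≠ k →
      HasDyad D l m ∨ HasDyad E l m := fun l m a b c d e f => by
    rcases hd l m a b c d e f with h | h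
    · exact .inl h
    · exact .inr ((he l m a b c d e f).resolve_right fun h' => hdis h h')
  obtain ⟨l, hl⟩ := exists_fresh (s := {i, j, k}) (N := N)
    (by have := Finset.card_le_three (a := i) (b := j) (c := k); omega)
  obtain ⟨m, hm⟩ := exists_fresh (s := {i, j, k, l}) (N := N)
    (by have := Finset.card_le_four (a := i) (b := j) (c := k) (d := l); omega)
  simp only [Finset.mem_insert, Finset.mem_singleton, not_or] at hl hm
  have hjk' : HasDyad D j k ∨ HasDyad E j k := by
    rcases hd l i hl.1 hl.2.1 hl.2.2 (Ne.symm hl.1) hij hik with h | h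
    · exact .inr ((he l i hl.1 hl.2.1 hl.2.2 (Ne.symm hl.1) hij hik).resolve_left
        fun h' => hdis h h')
    · exact .inl h
  constructor
  · intro v
    obtain ⟨x, y, hxy, rfl⟩ := v.exists_eq
    suffices h : HasDyad D x y ∨ HasDyad E x y from h.imp (fun h => h.2) fun h => h.2
    have hsymm : ∀ {p q}, HasDyad D p q ∨ HasDyad E p q → HasDyad D q p ∨ HasDyad E q p :=
      fun h => h.imp .symm .symm
    have hfree : ∀ {p q}, p ≠ i → p ≠ j → p ≠ k → p ≠ q → HasDyad D p q ∨ HasDyad E p q := by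
      intro p q a b c d
      by_cases hqj : q = j
      · exact .inl (hqj ▸ (hjl p a b c).symm)
      by_cases hqk : q = k
      · exact .inr (hqk ▸ (hkl p a b c).symm)
      exact hpair p q a b c d.symm hqj hqk
    by_cases hx : x ≠ i ∧ x ≠ j ∧ x ≠ k
    · exact hfree hx.1 hx.2.1 hx.2.2 hxy
    by_cases hy : y ≠ i ∧ y ≠ j ∧ y ≠ k
    · exact hsymm (hfree hy.1 hy.2.1 hy.2.2 hxy.symm)
    have hx' : x = i ∨ x = j ∨ x = k := by tauto
    have hy' : y = i ∨ y = j ∨ y = k := by tauto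
    rcases hx' with rfl | rfl | rfl <;> rcases hy' with rfl | rfl | rfl <;>
      first
      | exact absurd rfl hxy
      | exact .inl h1
      | exact .inl h1.symm
      | exact .inr h2
      | exact .inr h2.symm
      | exact hjk'
      | exact hsymm hjk'
  -- The dyads `jl` and `km` are disjoint because `l` and `m` are two different fresh nodes.
  · obtain ⟨hjl', hD'⟩ := hjl l hl.1 hl.2.1 hl.2.2
    obtain ⟨hkm', hE'⟩ := hkl m hm.1 hm.2.1 hm.2.2.1
    refine ⟨_, hD', _, hE', ?_⟩
    rw [incidenceGraph_adj]
    grind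

theorem rigid_incidenceGraph (hN : 5 ≤ Nat.card N) : Rigid (incidenceGraph N) where
  exists_middle a b hab hadj := by
    obtain ⟨p, q, hpq, rfl⟩ := a.exists_eq
    obtain ⟨r, s, hrs, rfl⟩ := b.exists_eq
    rw [incidenceGraph_adj] at hadj
    rw [ne_eq, dyad_inj] at hab
    have hpr : p ≠ r := by grind
    exact ⟨dyad p r hpr, unshielded_incidenceGraph_iff.2
      ⟨p, q, r, s, hpq, hpr, hrs, by grind, by grind, by grind, rfl, rfl, rfl⟩⟩
  exists_end a c hac := by
    classical
    obtain ⟨p, q, hpq, rfl⟩ := a.exists_eq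
    obtain ⟨r, s, hrs, rfl⟩ := c.exists_eq
    rw [incidenceGraph_adj] at hac
    obtain ⟨t, ht⟩ := exists_fresh (s := {p, q, r, s}) (N := N)
      (by have := Finset.card_le_four (a := p) (b := q) (c := r) (d := s); omega)
    simp only [Finset.mem_insert, Finset.mem_singleton, not_or] at ht
    by_cases h : r = p ∨ r = q
    · refine ⟨dyad s t (Ne.symm ht.2.2.2), ?_, ?_, ?_, ?_⟩ <;>
        simp only [incidenceGraph_adj, ne_eq, dyad_inj] <;> grind
    · refine ⟨dyad r t (Ne.symm ht.2.2.1), ?_, ?_, ?_, ?_⟩ <;>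
        simp only [incidenceGraph_adj, ne_eq, dyad_inj] <;> grind
  exists_nonadj a := by
    classical
    obtain ⟨p, q, hpq, rfl⟩ := a.exists_eq
    obtain ⟨r, hr⟩ := exists_fresh (s := {p, q}) (N := N)
      (by have := Finset.card_le_two (a := p) (b := q); omega)
    obtain ⟨s, hs⟩ := exists_fresh (s := {p, q, r}) (N := N)
      (by have := Finset.card_le_three (a := p) (b := q) (c := r); omega)
    simp only [Finset.mem_insert, Finset.mem_singleton, not_or] at hr hs
    refine ⟨dyad r s (Ne.symm hs.2.2), ?_, ?_⟩ <;>
      simp only [incidenceGraph_adj, ne_eq, dyad_inj] <;> grind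
  outsideClique D E hD hE hDne hEne hDE := by
    obtain ⟨x, hx⟩ := hDne
    obtain ⟨y, hy⟩ := hEne
    obtain ⟨p, q, hpq, rfl⟩ := x.exists_eq
    obtain ⟨r, s, hrs, rfl⟩ := y.exists_eq
    have hdis : ∀ {p q}, HasDyad D p q → HasDyad E p q → False := HasDyad.disjoint hDE
    have hx : HasDyad D p q := ⟨hpq, hx⟩
    have hy : HasDyad E r s := ⟨hrs, hy⟩
    have key : ∀ {i j k}, HasDyad D i j → HasDyad E i k →
        (∀ v, v ∈ D ∨ v ∈ E) ∧ ∃ x ∈ D, ∃ y ∈ E, ¬ (incidenceGraph N).Adj x y :=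
      fun {i j k} h1 h2 => outsideClique_incidence_aux hN hD hE hDE
        (by rintro rfl; exact hdis h1 h2) h1 h2
    by_cases h1 : p = r
    · subst h1; exact key hx hy
    by_cases h2 : p = s
    · subst h2; exact key hx hy.symm
    by_cases h3 : q = r
    · subst h3; exact key hx.symm hy
    by_cases h4 : q = s
    · subst h4; exact key hx.symm hy.symm
    -- Disjoint `pq` and `rs`: the triple `pr, pq, qs` moves a dyad incident to `rs` into `D`.
    rcases hD.incidence hx h1 h3 h2 h4 hrs with h | h
    · exact key h.symm hy
    · exact key h.symm hy.symm

theorem outsideClique_compl_aux {D E : Set (Dyad N)} (hN : 5 ≤ Nat.card N)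
    (hD : OutsideClique (incidenceGraph N)ᶜ D) (hE : OutsideClique (incidenceGraph N)ᶜ E)
    (hDE : Disjoint D E) {i j k l : N} (hik : i ≠ k) (hil : i ≠ l) (hjk : j ≠ k) (hjl : j ≠ l)
    (h1 : HasDyad D i j) (h2 : HasDyad E k l) :
    (∀ v, v ∈ D ∨ v ∈ E) ∧ ∃ x ∈ D, ∃ y ∈ E, ¬ (incidenceGraph N)ᶜ.Adj x y := by
  classical
  have hdis : ∀ {p q}, HasDyad D p q → HasDyad E p q → False := HasDyad.disjoint hDE
  have hij := h1.1
  have hkl := h2.1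
  have hkm : ∀ m, m ≠ i → m ≠ j → m ≠ k → m ≠ l → HasDyad D k m := fun m a b c d =>
    (hD.compl h1 hik hjk hil hjl a.symm b.symm hkl c.symm d.symm).resolve_left fun h => hdis h h2
  have hlm : ∀ m, m ≠ i → m ≠ j → m ≠ k → m ≠ l → HasDyad D l m := fun m a b c d =>
    (hD.compl h1 hil hjl hik hjk a.symm b.symm hkl.symm d.symm c.symm).resolve_left
      fun h => hdis h.symm h2
  have him : ∀ m, m ≠ i → m ≠ j → m ≠ k → m ≠ l → HasDyad E i m := fun m a b c d =>
    (hE.compl h2 hik.symm hil.symm hjk.symm hjl.symm c.symm d.symm hij a.symm b.symm).resolve_left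
      fun h => hdis h1 h
  have hjm : ∀ m, m ≠ i → m ≠ j → m ≠ k → m ≠ l → HasDyad E j m := fun m a b c d =>
    (hE.compl h2 hjk.symm hjl.symm hik.symm hil.symm c.symm d.symm hij.symm b.symm
      a.symm).resolve_left fun h => hdis h1 h.symm
  obtain ⟨m, hm⟩ := exists_fresh (s := {i, j, k, l}) (N := N)
    (by have := Finset.card_le_four (a := i) (b := j) (c := k) (d := l); omega)
  simp only [Finset.mem_insert, Finset.mem_singleton, not_or] at hm
  obtain ⟨m1, m2, m3, m4⟩ := hm
  have hkm' := hkm m m1 m2 m3 m4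
  have hlm' := hlm m m1 m2 m3 m4
  have him' := him m m1 m2 m3 m4
  have hjm' := hjm m m1 m2 m3 m4
  -- A sixth node `x` is impossible: `km ∈ D` is disjoint from `xi` and `xj`, so one of these would
  -- be in `D`, while both are in `E`. What remains is the Petersen graph.
  have hall : ∀ x, x = i ∨ x = j ∨ x = k ∨ x = l ∨ x = m := by
    by_contra! ⟨x, x1, x2, x3, x4, x5⟩
    rcases hD.compl hkm' x3.symm x5.symm hik.symm m1 hjk.symm m2 x1 x2 hij with h | h
    · exact hdis h.symm (him x x1 x2 x3 x4)
    · exact hdis h.symm (hjm x x1 x2 x3 x4)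
  -- Only `il, jl, ik, jk` are left. These four alternatives and disjointness put each of them into
  -- `D` or `E`.
  have e1 := hD.compl hkm' hkl m4 hik.symm m1 hjk.symm m2 hil.symm hjl.symm hij
  have e2 := hD.compl hlm' hkl.symm m3 hil.symm m1 hjl.symm m2 hik.symm hjk.symm hij
  have e3 := hE.compl him' hij m2 hik m3 hil m4 hjk hjl hkl
  have e4 := hE.compl hjm' hij.symm m1 hjk m3 hjl m4 hik hil hkl
  have hcov : (HasDyad D i l ∨ HasDyad E i l) ∧ (HasDyad D j l ∨ HasDyad E j l) ∧
      (HasDyad D i k ∨ HasDyad E i k) ∧ (HasDyad D j k ∨ HasDyad E j k) := by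
    have s1 : ∀ {p q}, HasDyad D p q → HasDyad D q p := HasDyad.symm
    have n1 := fun h : HasDyad D i l => hdis h
    have n2 := fun h : HasDyad D j l => hdis h
    have n3 := fun h : HasDyad D i k => hdis h
    have n4 := fun h : HasDyad D j k => hdis h
    replace e1 := e1.imp s1 s1
    replace e2 := e2.imp s1 s1
    tauto
  constructor
  · intro v
    obtain ⟨x, y, hxy, rfl⟩ := v.exists_eq
    suffices h : HasDyad D x y ∨ HasDyad E x y from h.imp (fun h => h.2) fun h => h.2
    have hsymm : ∀ {p q}, HasDyad D p q ∨ HasDyad E p q → HasDyad D q p ∨ HasDyad E q p :=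
      fun h => h.imp .symm .symm
    obtain ⟨c1, c2, c3, c4⟩ := hcov
    rcases hall x with rfl | rfl | rfl | rfl | rfl <;>
      rcases hall y with rfl | rfl | rfl | rfl | rfl <;>
      first
      | exact absurd rfl hxy
      | assumption
      | exact .inl ‹_›
      | exact .inr ‹_›
      | (apply hsymm; first | assumption | exact .inl ‹_› | exact .inr ‹_›)
  · refine ⟨_, h1.2, _, him'.2, ?_⟩
    rw [compl_incidenceGraph_adj]
    grind

theorem rigid_compl_incidenceGraph (hN : 5 ≤ Nat.card N) : Rigid (incidenceGraph N)ᶜ where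
  exists_middle a b hab hadj := by
    classical
    obtain ⟨p, q, hpq, rfl⟩ := a.exists_eq
    obtain ⟨r, s, hrs, rfl⟩ := b.exists_eq
    rw [compl_incidenceGraph_adj] at hadj
    rw [ne_eq, dyad_inj] at hab
    -- Incident dyads occupy only three nodes, so five nodes leave room for a dyad disjoint from
    -- both.
    have hcard : ({p, q, r, s} : Finset N).card ≤ 3 := by
      by_cases h : p = r ∨ p = s
      · have : ({p, q, r, s} : Finset N) = {q, r, s} := by grind
        rw [this]; exact Finset.card_le_three
      · have : ({p, q, r, s} : Finset N) = {p, r, s} := by grind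
        rw [this]; exact Finset.card_le_three
    obtain ⟨t, ht⟩ := exists_fresh (s := {p, q, r, s}) (N := N) (by omega)
    obtain ⟨u, hu⟩ := exists_fresh (s := insert t {p, q, r, s}) (N := N)
      (by have := Finset.card_insert_le t {p, q, r, s}; omega)
    simp only [Finset.mem_insert, Finset.mem_singleton, not_or] at ht hu
    refine ⟨dyad t u (Ne.symm hu.1), ?_, ?_, ?_, ?_⟩ <;>
      simp only [compl_incidenceGraph_adj, ne_eq, dyad_inj] <;> grind
  exists_end a c hac := by
    classical
    obtain ⟨p, q, hpq, rfl⟩ := a.exists_eq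
    obtain ⟨r, s, hrs, rfl⟩ := c.exists_eq
    rw [compl_incidenceGraph_adj] at hac
    obtain ⟨t, ht⟩ := exists_fresh (s := {p, q, r, s}) (N := N)
      (by have := Finset.card_le_four (a := p) (b := q) (c := r) (d := s); omega)
    simp only [Finset.mem_insert, Finset.mem_singleton, not_or] at ht
    refine ⟨dyad p t (Ne.symm ht.1), ?_, ?_, ?_, ?_⟩ <;>
      simp only [compl_incidenceGraph_adj, ne_eq, dyad_inj] <;> grind
  exists_nonadj a := by
    classical
    obtain ⟨p, q, hpq, rfl⟩ := a.exists_eq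
    obtain ⟨r, hr⟩ := exists_fresh (s := {p, q}) (N := N)
      (by have := Finset.card_le_two (a := p) (b := q); omega)
    simp only [Finset.mem_insert, Finset.mem_singleton, not_or] at hr
    refine ⟨dyad p r (Ne.symm hr.1), ?_, ?_⟩ <;>
      simp only [compl_incidenceGraph_adj, ne_eq, dyad_inj] <;> grind
  outsideClique D E hD hE hDne hEne hDE := by
    classical
    obtain ⟨x, hx⟩ := hDne
    obtain ⟨y, hy⟩ := hEne
    obtain ⟨p, q, hpq, rfl⟩ := x.exists_eq
    obtain ⟨r, s, hrs, rfl⟩ := y.exists_eq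
    have hdis : ∀ {p q}, HasDyad D p q → HasDyad E p q → False := HasDyad.disjoint hDE
    have hx : HasDyad D p q := ⟨hpq, hx⟩
    have hy : HasDyad E r s := ⟨hrs, hy⟩
    have aux := fun {i j k l : N} => outsideClique_compl_aux (i := i) (j := j) (k := k) (l := l)
      hN hD hE hDE
    have key : ∀ {i j k}, HasDyad D i j → HasDyad E i k →
        (∀ v, v ∈ D ∨ v ∈ E) ∧ ∃ x ∈ D, ∃ y ∈ E, ¬ (incidenceGraph N)ᶜ.Adj x y := by
      intro i j k h1 h2
      have hij := h1.1
      have hik := h2.1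
      have hjk : j ≠ k := by rintro rfl; exact hdis h1 h2
      obtain ⟨l, hl⟩ := exists_fresh (s := {i, j, k}) (N := N)
        (by have := Finset.card_le_three (a := i) (b := j) (c := k); omega)
      obtain ⟨m, hm⟩ := exists_fresh (s := {i, j, k, l}) (N := N)
        (by have := Finset.card_le_four (a := i) (b := j) (c := k) (d := l); omega)
      simp only [Finset.mem_insert, Finset.mem_singleton, not_or] at hl hm
      obtain ⟨l1, l2, l3⟩ := hl
      obtain ⟨m1, m2, m3, m4⟩ := hm
      -- From incident `ij ∈ D` and `ik ∈ E`, up to two forcing steps produce disjoint dyads, one in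
      -- `D` and one in `E`.
      rcases hD.compl h1 (Ne.symm m1) (Ne.symm m2) (Ne.symm l1) (Ne.symm l2) hik hjk m4 m3 l3
        with h | h
      · exact aux m1 m3 l1 l3 h h2
      rcases hE.compl h2 (Ne.symm l1) (Ne.symm l3) hij hjk.symm (Ne.symm m1) (Ne.symm m3) l2
        (Ne.symm m4) (Ne.symm m2) with h' | h'
      · exact aux m4 m2 (Ne.symm l3) hjk.symm h h'
      · exact aux (Ne.symm l1) (Ne.symm m1) (Ne.symm l2) (Ne.symm m2) h1 h'
    by_cases h1 : p = r
    · subst h1; exact key hx hy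
    by_cases h2 : p = s
    · subst h2; exact key hx hy.symm
    by_cases h3 : q = r
    · subst h3; exact key hx.symm hy
    by_cases h4 : q = s
    · subst h4; exact key hx.symm hy.symm
    exact aux h1 h2 h3 h4 hx hy

end Dyads

/-! ### Invariance of conditional independence -/

theorem condExp_comp_ae_eq {Ω : Type*} {m mΩ : MeasurableSpace Ω} {μ : Measure Ω}
    [IsFiniteMeasure μ] {f : Ω → Ω} (hf : MeasurePreserving f μ μ) (hm : m ≤ mΩ)
    {g : Ω → ℝ} (hg : Integrable g μ) :
    μ[g ∘ f | m.comap f] =ᵐ[μ] μ[g | m] ∘ f := by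
  have hm' : m.comap f ≤ mΩ := (MeasurableSpace.comap_mono hm).trans hf.measurable.comap_le
  symm
  refine ae_eq_condExp_of_forall_setIntegral_eq hm' (hf.integrable_comp_of_integrable hg) ?_ ?_ ?_
  · intro s _ _
    exact (hf.integrable_comp_of_integrable integrable_condExp).integrableOn
  · rintro _ ⟨s, hs, rfl⟩ _
    have h1 : ∀ h : Ω → ℝ, AEStronglyMeasurable h μ →
        ∫ x in f ⁻¹' s, (h ∘ f) x ∂μ = ∫ x in s, h x ∂μ := by
      intro h hh
      have := setIntegral_map (μ := μ) (hm s hs) (f := h) (g := f) (by rwa [hf.map_eq])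
        hf.measurable.aemeasurable
      rw [hf.map_eq] at this
      exact this.symm
    rw [h1 _ integrable_condExp.aestronglyMeasurable, h1 _ hg.aestronglyMeasurable,
      setIntegral_condExp hm hg hs]
  · exact (stronglyMeasurable_condExp.comp_measurable
      (comap_measurable f)).aestronglyMeasurable

/-- A measure-preserving map commutes with conditional probabilities, so the product formula can be
composed with `f`. -/
theorem CondIndep.comap {Ω : Type*} {m m₁ m₂ mΩ : MeasurableSpace Ω} [StandardBorelSpace Ω]
    {μ : Measure Ω} [IsFiniteMeasure μ] {f : Ω → Ω} (hf : MeasurePreserving f μ μ)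
    (hm : m ≤ mΩ) (hm₁ : m₁ ≤ mΩ) (hm₂ : m₂ ≤ mΩ)
    (hm' : m.comap f ≤ mΩ) (h : CondIndep m m₁ m₂ hm μ) :
    CondIndep (m.comap f) (m₁.comap f) (m₂.comap f) hm' μ := by
  have hcomap := hf.measurable.comap_le
  have hle : ∀ {m' : MeasurableSpace Ω}, m' ≤ mΩ → m'.comap f ≤ mΩ := fun hm =>
    (MeasurableSpace.comap_mono hm).trans hcomap
  rw [condIndep_iff _ _ _ _ (hle hm₁) (hle hm₂)]
  rw [condIndep_iff _ _ _ _ hm₁ hm₂] at h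
  rintro _ _ ⟨s, hs, rfl⟩ ⟨t, ht, rfl⟩
  have key : ∀ u, MeasurableSet[mΩ] u → μ⟦f ⁻¹' u | m.comap f⟧ =ᵐ[μ] μ⟦u | m⟧ ∘ f := by
    intro u hu
    exact condExp_comp_ae_eq hf hm (g := u.indicator fun _ => (1 : ℝ))
      ((integrable_const _).indicator hu)
  rw [← Set.preimage_inter]
  refine (key _ ((hm₁ s hs).inter (hm₂ t ht))).trans ?_
  refine (hf.quasiMeasurePreserving.ae_eq_comp (h s t hs ht)).trans ?_
  exact ((key s (hm₁ s hs)).mul (key t (hm₂ t ht))).symm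

/-- Coordinate `d` of the relabelled point is coordinate `σ d` of the original one. -/
theorem comap_cylinderEvents {V 𝒳 : Type*} [MeasurableSpace 𝒳] (σ : Equiv.Perm V) (A : Set V) :
    (cylinderEvents (X := fun _ : V => 𝒳) A).comap (fun x d => x (σ d)) =
      cylinderEvents (X := fun _ : V => 𝒳) (σ '' A) := by
  simp only [cylinderEvents, MeasurableSpace.comap_iSup, MeasurableSpace.comap_comp, iSup_image]
  rfl

theorem CondIndepCoords.image {V 𝒳 : Type*} [Finite V] [MeasurableSpace 𝒳] [StandardBorelSpace 𝒳]
    {P : Measure (V → 𝒳)} [IsProbabilityMeasure P] {σ : Equiv.Perm V}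
    (hσ : P.map (fun x d => x (σ d)) = P) {A B C : Set V} (h : CondIndepCoords P A B C) :
    CondIndepCoords P (σ '' A) (σ '' B) (σ '' C) := by
  have hf : MeasurePreserving (fun (x : V → 𝒳) d => x (σ d)) P P :=
    ⟨measurable_pi_lambda _ fun d => measurable_pi_apply _, hσ⟩
  have := CondIndep.comap hf cylinderEvents_le_pi cylinderEvents_le_pi cylinderEvents_le_pi
    ((comap_cylinderEvents σ C).trans_le cylinderEvents_le_pi) h
  simpa only [CondIndepCoords, comap_cylinderEvents] using this

/-! ### The test -/

section Test

open MixedGraph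

variable {N 𝒳 : Type*}

/-- The permutation of the dyads that is induced by a permutation of the nodes. -/
def Dyad.relabelEquiv (π : Equiv.Perm N) : Equiv.Perm (Dyad N) where
  toFun := Dyad.relabel π
  invFun := Dyad.relabel π.symm
  left_inv d := by
    obtain ⟨i, j, h, rfl⟩ := d.exists_eq
    apply Subtype.ext
    simp [Dyad.relabel, dyad]
  right_inv d := by
    obtain ⟨i, j, h, rfl⟩ := d.exists_eq
    apply Subtype.ext
    simp [Dyad.relabel, dyad]

theorem Dyad.relabelEquiv_dyad (π : Equiv.Perm N) {i j : N} (h : i ≠ j) :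
    Dyad.relabelEquiv π (dyad i j h) = dyad (π i) (π j) (π.injective.ne h) :=
  Subtype.ext (Sym2.map_mk ..)

theorem exists_perm_four {i j k l i' j' k' l' : N} (h : [i, j, k, l].Nodup)
    (h' : [i', j', k', l'].Nodup) :
    ∃ π : Equiv.Perm N, π i = i' ∧ π j = j' ∧ π k = k' ∧ π l = l' := by
  obtain ⟨π, hπ⟩ := Equiv.Perm.exists_extending_pair [i, j, k, l].get [i', j', k', l'].get
    (List.nodup_iff_injective_get.1 h) (List.nodup_iff_injective_get.1 h')
  exact ⟨π, hπ 0, hπ 1, hπ 2, hπ 3⟩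

theorem exists_perm_five {i j k l m i' j' k' l' m' : N} (h : [i, j, k, l, m].Nodup)
    (h' : [i', j', k', l', m'].Nodup) :
    ∃ π : Equiv.Perm N, π i = i' ∧ π j = j' ∧ π k = k' ∧ π l = l' ∧ π m = m' := by
  obtain ⟨π, hπ⟩ := Equiv.Perm.exists_extending_pair [i, j, k, l, m].get [i', j', k', l', m'].get
    (List.nodup_iff_injective_get.1 h) (List.nodup_iff_injective_get.1 h')
  exact ⟨π, hπ 0, hπ 1, hπ 2, hπ 3, hπ 4⟩

variable {G : MixedGraph (Dyad N)}

theorem tripleTransitive_incidenceGraph (hG : ∀ π, G.Preserves (Dyad.relabelEquiv π)) :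
    G.TripleTransitive (incidenceGraph N) := by
  intro a c b a' c' b' h h'
  obtain ⟨i, j, k, l, hij, hik, hkl, hil, hjk, hjl, rfl, rfl, rfl⟩ :=
    unshielded_incidenceGraph_iff.1 h
  obtain ⟨i', j', k', l', hij', hik', hkl', hil', hjk', hjl', rfl, rfl, rfl⟩ :=
    unshielded_incidenceGraph_iff.1 h'
  obtain ⟨π, rfl, rfl, rfl, rfl⟩ := exists_perm_four (i := i) (j := j) (k := k) (l := l)
    (i' := i') (j' := j') (k' := k') (l' := l') (by simp [*]) (by simp [*])
  exact ⟨_, hG π, Dyad.relabelEquiv_dyad π _, Dyad.relabelEquiv_dyad π _,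
    Dyad.relabelEquiv_dyad π _⟩

theorem tripleTransitive_compl_incidenceGraph (hG : ∀ π, G.Preserves (Dyad.relabelEquiv π)) :
    G.TripleTransitive (incidenceGraph N)ᶜ := by
  intro a c b a' c' b' h h'
  obtain ⟨i, j, k, l, m, hij, hik, hlm, hjk, hil, him, hjl, hjm, hkl, hkm, rfl, rfl, rfl⟩ :=
    unshielded_compl_incidenceGraph_iff.1 h
  obtain ⟨i', j', k', l', m', hij', hik', hlm', hjk', hil', him', hjl', hjm', hkl', hkm',
    rfl, rfl, rfl⟩ := unshielded_compl_incidenceGraph_iff.1 h'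
  obtain ⟨π, rfl, rfl, rfl, rfl, rfl⟩ := exists_perm_five (i := i) (j := j) (k := k) (l := l)
    (m := m) (i' := i') (j' := j') (k' := k') (l' := l') (m' := m') (by simp [*]) (by simp [*])
  exact ⟨_, hG π, Dyad.relabelEquiv_dyad π _, Dyad.relabelEquiv_dyad π _,
    Dyad.relabelEquiv_dyad π _⟩

/-- Pairs of disjoint dyads are all alike. -/
theorem inseparable_iff_of_disjoint (hG : ∀ π, G.Preserves (Dyad.relabelEquiv π)) {i j k l : N}
    {hij : i ≠ j} {hkl : k ≠ l} (hik : i ≠ k) (hil : i ≠ l) (hjk : j ≠ k) (hjl : j ≠ l)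
    {a b : Dyad N} (hab : (incidenceGraph N)ᶜ.Adj a b) :
    G.Inseparable a b ↔ G.Inseparable (dyad i j hij) (dyad k l hkl) := by
  have hne := hab.ne
  obtain ⟨p, q, hpq, rfl⟩ := a.exists_eq
  obtain ⟨r, s, hrs, rfl⟩ := b.exists_eq
  rw [compl_incidenceGraph_adj] at hab
  obtain ⟨h1, h2, h3, h4⟩ := hab
  obtain ⟨π, rfl, rfl, rfl, rfl⟩ := exists_perm_four (i := p) (j := q) (k := r) (l := s)
    (i' := i) (j' := j) (k' := k) (l' := l) (by simp [*]) (by simp [*])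
  rw [(hG π).inseparable_iff hne, Dyad.relabelEquiv_dyad, Dyad.relabelEquiv_dyad]

/-- Pairs of incident dyads are all alike. -/
theorem inseparable_iff_of_incident (hG : ∀ π, G.Preserves (Dyad.relabelEquiv π)) {i j k : N}
    {hij : i ≠ j} {hik : i ≠ k} (hjk : j ≠ k) {a b : Dyad N} (hab : (incidenceGraph N).Adj a b) :
    G.Inseparable a b ↔ G.Inseparable (dyad i j hij) (dyad i k hik) := by
  have hne := hab.ne
  obtain ⟨p, q, r, hpq, hpr, hqr, rfl, rfl⟩ : ∃ p q r, ∃ (hpq : p ≠ q) (hpr : p ≠ r),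
      q ≠ r ∧ a = dyad p q hpq ∧ b = dyad p r hpr := by
    obtain ⟨p, q, hpq, rfl⟩ := a.exists_eq
    obtain ⟨r, s, hrs, rfl⟩ := b.exists_eq
    rw [incidenceGraph_adj] at hab
    simp only [dyad_inj]
    rcases hab.2 with h | h | h | h
    · exact ⟨p, q, s, by grind⟩
    · exact ⟨p, q, r, by grind⟩
    · exact ⟨q, p, s, by grind⟩
    · exact ⟨q, p, r, by grind⟩
  obtain ⟨π, hπ⟩ := Equiv.Perm.exists_extending_pair [p, q, r].get [i, j, k].get
    (List.nodup_iff_injective_get.1 (by simp [*])) (List.nodup_iff_injective_get.1 (by simp [*]))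
  obtain rfl : π p = i := hπ 0
  obtain rfl : π q = j := hπ 1
  obtain rfl : π r = k := hπ 2
  rw [(hG π).inseparable_iff hne, Dyad.relabelEquiv_dyad, Dyad.relabelEquiv_dyad]

theorem preserves_relabelEquiv [Finite N] [MeasurableSpace 𝒳] [StandardBorelSpace 𝒳]
    {P : Measure (Dyad N → 𝒳)} [IsProbabilityMeasure P] (hP : IsExchangeable P)
    (hPG : IsFaithful P G) (π : Equiv.Perm N) : G.Preserves (Dyad.relabelEquiv π) := by
  have key : ∀ (π : Equiv.Perm N) (a b : Dyad N) (C : Set (Dyad N)), a ≠ b → a ∉ C → b ∉ C →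
      ¬ G.Connects C a b → ¬ G.Connects (Dyad.relabelEquiv π '' C) (Dyad.relabelEquiv π a)
        (Dyad.relabelEquiv π b) := by
    intro π a b C hab ha hb h
    rw [← separated_singleton, hPG _ _ _ (by simpa using hab) (by simpa using ha)
      (by simpa using hb)] at h
    have h' := h.image (σ := Dyad.relabelEquiv π) (hP π)
    rw [Set.image_singleton, Set.image_singleton] at h'
    rw [← separated_singleton, hPG _ _ _ (by simpa using hab) (by simpa using ha)
      (by simpa using hb)]
    exact h'
  intro a b C hab ha hb
  refine not_iff_not.1 ⟨key π a b C hab ha hb, fun h => ?_⟩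
  -- The converse is the same implication for the inverse relabelling.
  have := key π.symm _ _ _ ((Dyad.relabelEquiv π).injective.ne hab) (by simpa using ha)
    (by simpa using hb) h
  have e : Dyad.relabelEquiv π.symm = (Dyad.relabelEquiv π).symm := rfl
  simpa [e, Equiv.symm_image_image] using this

theorem pairIndep_iff [Finite N] [MeasurableSpace 𝒳] [StandardBorelSpace 𝒳]
    {P : Measure (Dyad N → 𝒳)} [IsProbabilityMeasure P] (hPG : IsFaithful P G) {a b : Dyad N}
    (hab : a ≠ b) {C : Set (Dyad N)} :
    PairIndep P a b C ↔ a ∉ C ∧ b ∉ C ∧ ¬ G.Connects C a b := by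
  refine and_congr_right fun ha => and_congr_right fun hb => ?_
  rw [← separated_singleton, hPG _ _ _ (by simpa using hab) (by simpa using ha)
      (by simpa using hb)]

theorem forall_not_pairIndep_iff [Finite N] [MeasurableSpace 𝒳] [StandardBorelSpace 𝒳]
    {P : Measure (Dyad N → 𝒳)} [IsProbabilityMeasure P] (hPG : IsFaithful P G) {a b : Dyad N}
    (hab : a ≠ b) : (∀ C, ¬ PairIndep P a b C) ↔ G.Inseparable a b := by
  refine forall_congr' fun C => ?_
  rw [pairIndep_iff hPG hab]
  tauto

/-! ### Separators in undirected and bidirected graphs -/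

theorem not_connects_undirected {V : Type*} {S : SimpleGraph V} {a b : V} (hab : a ≠ b)
    (hS : ¬ S.Adj a b) : ¬ (undirected S).Connects {a, b}ᶜ a b := by
  rw [connects_undirected_iff (by simp)]
  intro h
  have key : ∀ v, Joined S {a, b}ᶜ a v → v = a := by
    intro v hv
    induction hv with
    | refl => rfl
    | tail _ h ih =>
      subst ih
      have h2 := h.2
      simp only [Set.mem_compl_iff, Set.mem_insert_iff, Set.mem_singleton_iff, not_not] at h2
      rcases h2 with rfl | rfl
      · rfl
      · exact absurd h.1 hS
  exact hab (key b h).symm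

/-- With nothing to hit, no collider section can be passed, so a connecting walk has at most one
arc. -/
theorem not_connects_bidirected {V : Type*} {S : SimpleGraph V} {a b : V} (hab : a ≠ b)
    (hS : ¬ S.Adj a b) : ¬ (bidirected S).Connects ∅ a b := by
  rintro ⟨h, hr⟩
  have key : ∀ s, (bidirected S).Reach ∅ a s →
      ¬ s.hit ∧ (s.vert = a ∧ ¬ s.head ∨ s.head ∧ S.Adj a s.vert) := by
    intro s hs
    induction hs with
    | refl => exact ⟨id, .inl ⟨rfl, id⟩⟩
    | tail _ hst ih =>
      cases hst with
      | line hl => exact hl.elim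
      | forward h _ => exact h.elim
      | backward h _ => exact h.elim
      | arc h ht =>
        obtain ⟨h1, ⟨rfl, -⟩ | ⟨h2, -⟩⟩ := ih
        · exact ⟨id, .inr ⟨trivial, h⟩⟩
        · exact absurd (ht.2 h2) h1
  rcases (key _ hr).2 with ⟨h, -⟩ | ⟨-, h⟩
  · exact hab h.symm
  · exact hS h

theorem inseparable_undirected_iff {V : Type*} {S : SimpleGraph V} {a b : V} (hab : a ≠ b) :
    (undirected S).Inseparable a b ↔ S.Adj a b :=
  ⟨fun h => by_contra fun hS => not_connects_undirected hab hS (h _ (by simp) (by simp)),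
    fun h => inseparable_of_edgeAdj hab ⟨.line, h⟩⟩

theorem inseparable_bidirected_iff {V : Type*} {S : SimpleGraph V} {a b : V} (hab : a ≠ b) :
    (bidirected S).Inseparable a b ↔ S.Adj a b :=
  ⟨fun h => by_contra fun hS => not_connects_bidirected hab hS (h _ (by simp) (by simp)),
    fun h => inseparable_of_edgeAdj hab ⟨.arc, h⟩⟩

end Test

open MixedGraph

/-- If an exchangeable network distribution is faithful to a (chain mixed) graph `G`, then the
test gives exactly one answer, whichever five distinct nodes and whichever separating sets it
uses, and the answer is the regime to whose graph `G` is Markov equivalent. -/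
theorem mainTheorem7 {N 𝒳 : Type*} [Finite N] [MeasurableSpace 𝒳] [StandardBorelSpace 𝒳]
    (P : Measure (Dyad N → 𝒳)) [IsProbabilityMeasure P] (hP : IsExchangeable P)
    (G : MixedGraph (Dyad N)) (hG : G.IsChainMixed) (hPG : IsFaithful P G)
    (i j k l m : N) (hij : i ≠ j) (hik : i ≠ k) (hil : i ≠ l) (him : i ≠ m) (hjk : j ≠ k)
    (hjl : j ≠ l) (hjm : j ≠ m) (hkl : k ≠ l) (hkm : k ≠ m) (hlm : l ≠ m) :
    (∃! r : Regime, TestOutputs P (dyad i j hij) (dyad k l hkl) (dyad i k hik) (dyad l m hlm) r) ∧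
    ∀ r : Regime,
      TestOutputs P (dyad i j hij) (dyad k l hkl) (dyad i k hik) (dyad l m hlm) r ↔
        G.MarkovEquiv (r.graph N) := by
  classical
  have hN : 5 ≤ Nat.card N := by
    have h : ({i, j, k, l, m} : Finset N).card = 5 := by
      simp [Finset.card_insert_of_notMem, *]
    rw [← h, ← Set.ncard_coe_finset, ← Set.ncard_univ]
    exact Set.ncard_le_ncard (Set.subset_univ _)
  have hpres := preserves_relabelEquiv hP hPG
  have hdis : ∀ {a b : Dyad N}, (incidenceGraph N)ᶜ.Adj a b →
      (G.Inseparable a b ↔ G.Inseparable (dyad i j hij) (dyad k l hkl)) :=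
    inseparable_iff_of_disjoint hpres hik hil hjk hjl
  have hinc : ∀ {a b : Dyad N}, (incidenceGraph N).Adj a b →
      (G.Inseparable a b ↔ G.Inseparable (dyad i j hij) (dyad i k hik)) :=
    inseparable_iff_of_incident hpres hjk
  have hT := tripleTransitive_incidenceGraph hpres
  have hT' := tripleTransitive_compl_incidenceGraph hpres
  have hR := rigid_incidenceGraph hN
  have hR' := rigid_compl_incidenceGraph hN
  have htri : Unshielded (incidenceGraph N) (dyad i j hij) (dyad i k hik) (dyad k l hkl) :=
    unshielded_incidenceGraph_iff.2 ⟨i, j, k, l, hij, hik, hkl, hil, hjk, hjl, rfl, rfl, rfl⟩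
  have htri' : Unshielded (incidenceGraph N)ᶜ (dyad i j hij) (dyad l m hlm) (dyad i k hik) :=
    unshielded_compl_incidenceGraph_iff.2 ⟨i, j, k, l, m, hij, hik, hlm, hjk, hil, him, hjl, hjm,
      hkl, hkm, rfl, rfl, rfl⟩
  have hadj : ¬ (incidenceGraph N).Adj (dyad i j hij) (dyad k l hkl) := htri.nadj
  have hadj' : (incidenceGraph N).Adj (dyad i j hij) (dyad i k hik) := htri.left
  have hcadj : (incidenceGraph N)ᶜ.Adj (dyad i j hij) (dyad k l hkl) := ⟨htri.ne, hadj⟩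
  have hcadj' : ¬ (incidenceGraph N)ᶜ.Adj (dyad i j hij) (dyad i k hik) := htri'.nadj
  have hSL : ¬ G.Inseparable (dyad i j hij) (dyad k l hkl) →
      G.Inseparable (dyad i j hij) (dyad i k hik) →
      ∀ a b, a ≠ b → ((incidenceGraph N).Adj a b ↔ G.Inseparable a b) := by
    intro h1 h2 a b hab
    exact ⟨fun h => (hinc h).2 h2, fun h => by_contra fun hcon => h1 ((hdis ⟨hab, hcon⟩).1 h)⟩
  have hSC : G.Inseparable (dyad i j hij) (dyad k l hkl) →
      ¬ G.Inseparable (dyad i j hij) (dyad i k hik) →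
      ∀ a b, a ≠ b → ((incidenceGraph N)ᶜ.Adj a b ↔ G.Inseparable a b) := by
    intro h1 h2 a b hab
    exact ⟨fun h => (hdis h).2 h1, fun h => ⟨hab, fun hcon => h2 ((hinc hcon).1 h)⟩⟩
  have hsep : ∀ {a b : Dyad N} {C}, a ≠ b → PairIndep P a b C → ¬ G.Inseparable a b :=
    fun hab h hi => ((pairIndep_iff hPG hab).1 h).2.2 (hi _ h.1 h.2.1)
  have hins : ∀ {a b : Dyad N}, a ≠ b → (∀ C, ¬ PairIndep P a b C) → G.Inseparable a b :=
    fun hab => (forall_not_pairIndep_iff hPG hab).1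
  have hne := htri.ne
  have hne' := htri'.ne
  have hsound : ∀ r, TestOutputs P (dyad i j hij) (dyad k l hkl) (dyad i k hik) (dyad l m hlm) r →
      G.MarkovEquiv (r.graph N) := by
    intro r hr
    cases hr with
    | empty C C' h1 h2 =>
      refine markovEquiv_empty fun a b hab => ?_
      by_cases h : (incidenceGraph N).Adj a b
      · rw [hinc h]; exact hsep hne' h2
      · rw [hdis ⟨hab, h⟩]; exact hsep hne h1
    | undirectedIncidence C h1 h2 h3 =>
      exact markovEquiv_undirected_of_mem_separator hG hR (hSL (hsep hne h1) (hins hne' h2)) hT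
        htri h1.1 h1.2.1 ((pairIndep_iff hPG hne).1 h1).2.2 h3
    | bidirectedIncidence C h1 h2 h3 =>
      exact markovEquiv_bidirected_of_notMem_separator hR (hSL (hsep hne h1) (hins hne' h2)) hT
        htri h1.1 h1.2.1 ((pairIndep_iff hPG hne).1 h1).2.2 h3
    | undirectedCompl C h1 h2 h3 =>
      exact markovEquiv_undirected_of_mem_separator hG hR' (hSC (hins hne h1) (hsep hne' h2)) hT'
        htri' h2.1 h2.2.1 ((pairIndep_iff hPG hne').1 h2).2.2 h3
    | bidirectedCompl C h1 h2 h3 =>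
      exact markovEquiv_bidirected_of_notMem_separator hR' (hSC (hins hne h1) (hsep hne' h2)) hT'
        htri' h2.1 h2.2.1 ((pairIndep_iff hPG hne').1 h2).2.2 h3
    | complete h1 h2 =>
      refine markovEquiv_of_forall_inseparable (fun a b hab => ?_) fun a b hab =>
        (inseparable_undirected_iff hab).2 hab
      by_cases h : (incidenceGraph N).Adj a b
      · rw [hinc h]; exact hins hne' h2
      · rw [hdis ⟨hab, h⟩]; exact hins hne h1
  -- The separators shown to the test are the complement of the pair for undirected graphs, which
  -- contains the probing dyad, and `∅` for bidirected ones, which does not.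
  have hcomplete : ∀ r, G.MarkovEquiv (r.graph N) →
      TestOutputs P (dyad i j hij) (dyad k l hkl) (dyad i k hik) (dyad l m hlm) r := by
    intro r hr
    have hindep : ∀ {a b : Dyad N} {C}, a ≠ b → a ∉ C → b ∉ C → ¬ (r.graph N).Connects C a b →
        PairIndep P a b C := fun hab ha hb h =>
      (pairIndep_iff hPG hab).2 ⟨ha, hb, fun h' => h ((markovEquiv_iff.1 hr _ _ _ hab ha hb).1 h')⟩
    have hnindep : ∀ {a b : Dyad N}, a ≠ b → (r.graph N).Inseparable a b →
        ∀ C, ¬ PairIndep P a b C := fun hab h =>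
      (forall_not_pairIndep_iff hPG hab).2 ((hr.inseparable_iff hab).2 h)
    cases r with
    | empty =>
      exact .empty _ _ (hindep hne (by simp) (by simp) (not_connects_undirected hne id))
        (hindep hne' (by simp) (by simp) (not_connects_undirected hne' id))
    | undirectedIncidence =>
      exact .undirectedIncidence _
        (hindep hne (by simp) (by simp) (not_connects_undirected hne hadj))
        (hnindep hne' ((inseparable_undirected_iff hne').2 hadj'))
        (by simpa using ⟨hne'.symm, htri.right.ne⟩)
    | bidirectedIncidence =>
      exact .bidirectedIncidence _
        (hindep hne (by simp) (by simp) (not_connects_bidirected hne hadj))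
        (hnindep hne' ((inseparable_bidirected_iff hne').2 hadj')) (by simp)
    | undirectedCompl =>
      exact .undirectedCompl _ (hnindep hne ((inseparable_undirected_iff hne).2 hcadj))
        (hindep hne' (by simp) (by simp) (not_connects_undirected hne' hcadj'))
        (by simpa using ⟨htri'.left.ne.symm, htri'.right.ne⟩)
    | bidirectedCompl =>
      exact .bidirectedCompl _ (hnindep hne ((inseparable_bidirected_iff hne).2 hcadj))
        (hindep hne' (by simp) (by simp) (not_connects_bidirected hne' hcadj')) (by simp)
    | complete =>
      exact .complete (hnindep hne ((inseparable_undirected_iff hne).2 hne))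
        (hnindep hne' ((inseparable_undirected_iff hne').2 hne'))
  refine ⟨?_, fun r => ⟨hsound r, hcomplete r⟩⟩
  have hex : ∃ r, TestOutputs P (dyad i j hij) (dyad k l hkl) (dyad i k hik) (dyad l m hlm) r := by
    by_cases h1 : ∀ C, ¬ PairIndep P (dyad i j hij) (dyad k l hkl) C <;>
      by_cases h2 : ∀ C, ¬ PairIndep P (dyad i j hij) (dyad i k hik) C
    · exact ⟨_, .complete h1 h2⟩
    · push Not at h2
      obtain ⟨C, hC⟩ := h2
      by_cases h3 : dyad l m hlm ∈ C
      · exact ⟨_, .undirectedCompl C h1 hC h3⟩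
      · exact ⟨_, .bidirectedCompl C h1 hC h3⟩
    · push Not at h1
      obtain ⟨C, hC⟩ := h1
      by_cases h3 : dyad i k hik ∈ C
      · exact ⟨_, .undirectedIncidence C hC h2 h3⟩
      · exact ⟨_, .bidirectedIncidence C hC h2 h3⟩
    · push Not at h1 h2
      obtain ⟨C, hC⟩ := h1
      obtain ⟨C', hC'⟩ := h2
      exact ⟨_, .empty C C' hC hC'⟩
  -- Separators that disagree on the middle dyad would make it both anterior and not anterior to an
  -- end.
  have hclashL : ∀ {C D : Set (Dyad N)}, dyad i k hik ∈ C → dyad i k hik ∉ D →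
      PairIndep P (dyad i j hij) (dyad k l hkl) C → PairIndep P (dyad i j hij) (dyad k l hkl) D →
      (∀ C', ¬ PairIndep P (dyad i j hij) (dyad i k hik) C') → False := by
    intro C D hmC hmD hC hD h
    have hS := hSL (hsep hne hC) (hins hne' h)
    exact notMem_antPair_of_notMem_separator hS htri hD.1 hD.2.1
      ((pairIndep_iff hPG hne).1 hD).2.2 hmD (mem_antPair_of_mem_separator hG hS htri hC.1 hC.2.1
      ((pairIndep_iff hPG hne).1 hC).2.2 hmC)
  have hclashC : ∀ {C D : Set (Dyad N)}, dyad l m hlm ∈ C → dyad l m hlm ∉ D →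
      PairIndep P (dyad i j hij) (dyad i k hik) C → PairIndep P (dyad i j hij) (dyad i k hik) D →
      (∀ C', ¬ PairIndep P (dyad i j hij) (dyad k l hkl) C') → False := by
    intro C D hmC hmD hC hD h
    have hS := hSC (hins hne h) (hsep hne' hC)
    exact notMem_antPair_of_notMem_separator hS htri' hD.1 hD.2.1
      ((pairIndep_iff hPG hne').1 hD).2.2 hmD (mem_antPair_of_mem_separator hG hS htri' hC.1 hC.2.1
      ((pairIndep_iff hPG hne').1 hC).2.2 hmC)
  obtain ⟨r, hr⟩ := hex
  refine ⟨r, hr, fun r' hr' => ?_⟩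
  cases hr <;> cases hr' <;>
    first
    | rfl
    | exact absurd ‹PairIndep P (dyad i j hij) (dyad k l hkl) _›
        (‹∀ C, ¬ PairIndep P (dyad i j hij) (dyad k l hkl) C› _)
    | exact absurd ‹PairIndep P (dyad i j hij) (dyad i k hik) _›
        (‹∀ C, ¬ PairIndep P (dyad i j hij) (dyad i k hik) C› _)
    | exact (hclashL ‹_› ‹_› ‹_› ‹_› ‹_›).elim
    | exact (hclashC ‹_› ‹_› ‹_› ‹_› ‹_›).elim
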